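/- **Setting.** A seller with constant marginal cost $c>0$ sells a quantity $q\ge 0$ to a buyer with payoff $u(v,q,t)=vq^{\alpha}-t$, $\alpha\in(0,1)$. In period 0 the buyer privately observes a signal $\theta\in[\underline\theta,\overline\theta]$, $0\le\underline\theta<\overline\theta$, with distribution function $F$ and density $f>0$. In period 1 the buyer observes the value $v=\theta z$, where $z$ is independent of $\theta$ and has a density $h$ on $[\underline z,\overline z]$, $0\le\underline z<\overline z$, positive on the interior. Let $G(v\mid\theta)$ be the conditional distribution function of $v$ and $V=[\underline v,\overline v]=[\underline\theta\,\underline z,\overline\theta\,\overline z]$. Put $\varphi_F(\theta)=\theta-\frac{1-F(\theta)}{f(\theta)}$ and $\varphi(\theta,v)=v\,\varphi_F(\theta)/\theta$, and assume the monotone hazard rate condition: $(1-F)/f$ is weakly decreasing on $[\underline\theta,\overline\theta]$. **Benchmark.** Without a spot market, $(q^*,t^*)$ is given by $$q^*(\theta,v)=\Big(\tfrac{\alpha}{c}\,\varphi(\theta,v)\,\mathbb 1_{[\varphi(\theta,v)\ge 0]}\Big)^{\frac1{1-\alpha}},\qquad t^*(\theta,v)=v\,q^*(\theta,v)^{\alpha}-u^*(\theta,v),$$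 where $u^*(\theta,v)=u^*(\theta,\underline v)+\int_{\underline v}^{v}q^*(\theta,x)^{\alpha}dx$ and $$u^*(\theta):=\mathbb E[u^*(\theta,v)\mid\theta]=-\int_{\underline\theta}^{\theta}\int_{\underline v}^{\overline v}q^*(x,v)^{\alpha}\,\frac{\partial G(v\mid x)}{\partial x}\,dv\,dx .$$ **Spot market.** Let $p^S>c$ and $u^S(\theta)=\mathbb E\big[\max_{q\ge 0}\{vq^{\alpha}-p^Sq\}\mid\theta\big]$. A constrained-optimal mechanism $(q^D,t^D)$ maximizes $\mathbb E[t(\theta,v)-c\,q(\theta,v)]$ over measurable mechanisms $(q,t)$ on $[\underline\theta,\overline\theta]\times V$ with $q\ge 0$ and $t-cq$ integrable under the joint law of $(\theta,v)$ such that, for all $\theta,\theta'\in[\underline\theta,\overline\theta]$ and $v,v'\in V$, * (IC0) $\mathbb E[u(v,q(\theta,v),t(\theta,v))\mid\theta]\ge\mathbb E[u(v,q(\theta',v),t(\theta',v))\mid\theta]$; * (IC1) $u(v,q(\theta,v),t(\theta,v))\ge u(v,q(\theta,v'),t(\theta,v'))$; * (IR) $\mathbb E[u(v,q(\theta,v),t(\theta,v))\mid\theta]\ge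 u^S(\theta)$. **Proposition (Optimal Contract with Spot Market).** Let $\theta^*\in[\underline\theta,\overline\theta]$ be the cutoff determined by $$\frac{\varphi_F(\theta^*)}{\theta^*}=\frac{c}{p^S},$$ with $\theta^*=\underline\theta$ if $\underline\theta>0$ and $\varphi_F(\underline\theta)/\underline\theta>c/p^S$. If $f$ is continuous, there is exactly one such $\theta^*$. For every such $\theta^*$ put $t_c=u^S(\theta^*)-u^*(\theta^*)$. Then: 1. $t_c\ge 0$. 2. There is a constrained-optimal mechanism $(q^D,t^D)$ such that, for every $\theta$, $q^D(\theta,\cdot)=q^*(\theta,\cdot)$ on $V$ if and only if $\theta\ge\theta^*$, and $t^D(\theta,v)=t^*(\theta,v)-t_c$ for all $\theta\ge\theta^*$ and $v\in V$. 3. For every constrained-optimal mechanism $(q^D,t^D)$ and almost every $\theta$: $q^D(\theta,v)=q^*(\theta,v)$ for $G(\cdot\mid\theta)$-almost every $v$ if and only if $\theta\ge\theta^*$; and if $\theta\ge\theta^*$, then $t^D(\theta,v)=t^*(\theta,v)-t_c$ for $G(\cdot\mid\theta)$-almost every $v$. -/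

import Mathlib

open MeasureTheory Set

noncomputable section

/-- Primitives of the two-period screening problem with multiplicative values `v = θ z`:
elasticity `α`, marginal cost `c`, a signal `θ` with density `f` on `[θlo, θhi]`, and an independent
shock `z` with density `h` on `[zlo, zhi]`. -/
structure ServiceMarket where
  α : ℝ
  c : ℝ
  θlo : ℝ
  θhi : ℝ
  zlo : ℝ
  zhi : ℝ
  f : ℝ → ℝ
  h : ℝ → ℝ
  α_pos : 0 < α
  α_lt_one : α < 1
  c_pos : 0 < c
  θlo_nonneg : 0 ≤ θlo
  θlo_lt : θlo < θhi
  zlo_nonneg : 0 ≤ zlo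
  zlo_lt : zlo < zhi
  f_meas : Measurable f
  f_pos : ∀ θ ∈ Icc θlo θhi, 0 < f θ
  f_integral : ∫ θ in θlo..θhi, f θ = 1
  h_meas : Measurable h
  h_nonneg : ∀ z ∈ Icc zlo zhi, 0 ≤ h z
  h_pos : ∀ z ∈ Ioo zlo zhi, 0 < h z
  h_integral : ∫ z in zlo..zhi, h z = 1

namespace ServiceMarket

variable (E : ServiceMarket)

/-- The set of signals. -/
def signals : Set ℝ := Icc E.θlo E.θhi

/-- Lowest value. -/
def vlo : ℝ := E.θlo * E.zlo

/-- Highest value. -/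
def vhi : ℝ := E.θhi * E.zhi

/-- The set of values that can be reported. -/
def values : Set ℝ := Icc E.vlo E.vhi

/-- Distribution of the signal `θ`. -/
def signalLaw : Measure ℝ :=
  (volume.restrict (Icc E.θlo E.θhi)).withDensity fun θ => ENNReal.ofReal (E.f θ)

/-- Distribution of the shock `z`. -/
def shockLaw : Measure ℝ :=
  (volume.restrict (Icc E.zlo E.zhi)).withDensity fun z => ENNReal.ofReal (E.h z)

/-- Conditional distribution of `v = θ z` given `θ`. -/
def valueLaw (θ : ℝ) : Measure ℝ := E.shockLaw.map fun z => θ * z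

/-- Joint distribution of `(θ, v)`. -/
def jointLaw : Measure (ℝ × ℝ) :=
  (E.signalLaw.prod E.shockLaw).map fun x => (x.1, x.1 * x.2)

/-- `F(θ)`, the distribution function of the signal. -/
def F (θ : ℝ) : ℝ := ∫ x in E.θlo..θ, E.f x

/-- `G(v ∣ θ)`, the conditional distribution function of the value. -/
def G (θ v : ℝ) : ℝ := (E.valueLaw θ).real (Iic v)

/-- `∂G(v ∣ θ)/∂θ`. -/
def dG (θ v : ℝ) : ℝ := deriv (fun x => E.G x v) θ

/-- The one-dimensional virtual value `φ_F(θ) = θ - (1 - F(θ)) / f(θ)`. -/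
def virtualF (θ : ℝ) : ℝ := θ - (1 - E.F θ) / E.f θ

/-- Monotone hazard rate: `(1 - F) / f` is (weakly) decreasing. -/
def MonotoneHazardRate : Prop := AntitoneOn (fun θ => (1 - E.F θ) / E.f θ) E.signals

/-- The dynamic virtual value, which for `v = θ z` is `z φ_F(θ) = v φ_F(θ) / θ`. -/
def virtual (θ v : ℝ) : ℝ := v * (E.virtualF θ / θ)

/-- Buyer's payoff `v q ^ α - t`. -/
def payoff (v q t : ℝ) : ℝ := v * q ^ E.α - t

/-- `E[u(v, q(θ', v), t(θ', v)) ∣ θ]`: expected payoff of signal `θ` reporting `θ'` in period 0 and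
then the true value in period 1. -/
def interimUtility (q t : ℝ → ℝ → ℝ) (θ θ' : ℝ) : ℝ :=
  ∫ v, E.payoff v (q θ' v) (t θ' v) ∂(E.valueLaw θ)

/-- Period-0 incentive compatibility. -/
def IC0 (q t : ℝ → ℝ → ℝ) : Prop :=
  ∀ θ ∈ E.signals, ∀ θ' ∈ E.signals, E.interimUtility q t θ θ' ≤ E.interimUtility q t θ θ

/-- Period-1 incentive compatibility. -/
def IC1 (q t : ℝ → ℝ → ℝ) : Prop :=
  ∀ θ ∈ E.signals, ∀ v ∈ E.values, ∀ v' ∈ E.values,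
    E.payoff v (q θ v') (t θ v') ≤ E.payoff v (q θ v) (t θ v)

/-- Payoff of value `v` on a spot market with unit price `p`: `max_{q ≥ 0} (v q ^ α - p q)`. -/
def spotPayoff (p v : ℝ) : ℝ := sSup ((fun q => E.payoff v q (p * q)) '' Ici 0)

/-- `u^S(θ)`, the expected spot-market payoff of signal `θ`. -/
def spotUtility (p θ : ℝ) : ℝ := ∫ v, E.spotPayoff p v ∂(E.valueLaw θ)

/-- Seller's expected profit `E[t(θ, v) - c q(θ, v)]`. -/
def profit (q t : ℝ → ℝ → ℝ) : ℝ :=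
  ∫ x, (t x.1 x.2 - E.c * q x.1 x.2) ∂E.jointLaw

/-- The mechanisms the seller can choose from when there is a spot market with unit price `p`:
measurable mechanisms with a well-defined expected profit that satisfy both incentive constraints
and give each signal at least its spot-market utility. -/
structure IsFeasible (p : ℝ) (q t : ℝ → ℝ → ℝ) : Prop where
  q_meas : Measurable (Function.uncurry q)
  t_meas : Measurable (Function.uncurry t)
  q_nonneg : ∀ θ ∈ E.signals, ∀ v ∈ E.values, 0 ≤ q θ v
  profit_integrable : Integrable (fun x : ℝ × ℝ => t x.1 x.2 - E.c * q x.1 x.2) E.jointLaw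
  ic0 : E.IC0 q t
  ic1 : E.IC1 q t
  ir : ∀ θ ∈ E.signals, E.spotUtility p θ ≤ E.interimUtility q t θ θ

/-- Constrained-optimal mechanisms `(q^D, t^D)` in the presence of the spot market. -/
def IsOptimal (p : ℝ) (q t : ℝ → ℝ → ℝ) : Prop :=
  E.IsFeasible p q t ∧ ∀ q' t', E.IsFeasible p q' t' → E.profit q' t' ≤ E.profit q t

open Classical in
/-- The benchmark allocation without spot market,
`q*(θ, v) = ((α / c) φ(θ, v) 1[φ(θ, v) ≥ 0]) ^ (1 / (1 - α))`. -/
def qStar (θ v : ℝ) : ℝ :=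
  (E.α / E.c * (if 0 ≤ E.virtual θ v then E.virtual θ v else 0)) ^ (1 / (1 - E.α))

/-- Interim rent in the benchmark, from the period-0 envelope condition with binding
participation at `θlo`: `-∫_{θlo}^θ ∫_{vlo}^{vhi} q*(x, v) ^ α ∂G(v ∣ x)/∂x dv dx`. -/
def interimRentStar (θ : ℝ) : ℝ :=
  -∫ x in E.θlo..θ, ∫ v in E.vlo..E.vhi, E.qStar x v ^ E.α * E.dG x v

/-- `∫_{vlo}^v q*(θ, x) ^ α dx`, the period-1 envelope. -/
def envelopeStar (θ v : ℝ) : ℝ := ∫ x in E.vlo..v, E.qStar θ x ^ E.α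

/-- Ex-post rent `u(θ, v) = u(θ, vlo) + ∫_{vlo}^v q*(θ, x) ^ α dx` in the benchmark, with
`u(θ, vlo)` such that the conditional mean given `θ` is `interimRentStar θ`. -/
def exPostRentStar (θ v : ℝ) : ℝ :=
  (E.interimRentStar θ - ∫ v', E.envelopeStar θ v' ∂(E.valueLaw θ)) + E.envelopeStar θ v

/-- Benchmark transfers `t*(θ, v) = v q*(θ, v) ^ α - u(θ, v)`. -/
def tStar (θ v : ℝ) : ℝ := v * E.qStar θ v ^ E.α - E.exPostRentStar θ v

/-- `u*(θ)`, the expected utility of signal `θ` in the benchmark mechanism. -/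
def uStar (θ : ℝ) : ℝ := E.interimUtility E.qStar E.tStar θ θ

/-- `θs` is the cutoff: the solution in `[θlo, θhi]` of `φ_F(θs) / θs = c / p`, or `θlo` if the
ratio `φ_F(θ) / θ` is above `c / p` already at the lowest signal. -/
def IsCutoff (p θs : ℝ) : Prop :=
  θs ∈ E.signals ∧
    (E.virtualF θs / θs = E.c / p ∨ (θs = E.θlo ∧ E.c / p < E.virtualF E.θlo / E.θlo))

/-- The discount `t_c = u^S(θs) - u*(θs)`. -/
def discount (p θs : ℝ) : ℝ := E.spotUtility p θs - E.uStar θs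

end ServiceMarket

end

/-!
A feasible mechanism is reduced to three functions of the signal: the interim rent `U`, the marginal
rent `Q(θ) = E[z q ^ α ∣ θ]` and the expected quantity `K`. Period-1 incentive compatibility makes
`q ^ α` a subgradient of the ex-post payoff in `v`; since `v = θ z`, period-0 incentive
compatibility makes `Q` a subgradient of `U` (`IsFeasible.rent_subgradient`). Hence `Q` is
increasing, `U` is its primitive (`integral_subgradient`), and no regularity of the mechanism is
needed. The expected profit is `∫ f (θ Q - U - c K)`.

Let `σ(θ)` be `c / p` below the cutoff and `φ_F(θ) / θ` from the cutoff on (`cutoffFraction`); it is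
increasing by the monotone hazard rate. The candidate optimum serves each value `v` the quantity
that maximizes `σ(θ) v q ^ α - c q`, which is spot-market demand below the cutoff and the benchmark
quantity above it, and leaves the spot-market utility to all signals up to the cutoff. The profit
it earns in excess of another feasible mechanism splits into two terms
(`IsFeasible.profit_sub_profit`).

The first is the loss in virtual surplus `∫ f (σ θ Q - c K)`, which is nonnegative pointwise, and
zero only if the quantities agree almost everywhere.

The second is `∫ f (D - θ (1 - σ) δ)`, where `D` is the difference in rents and `δ = D'` that in
marginal rents. Here `f θ (1 - σ) = 1 - F - g` with `g = 1 - F - (1 - c / p) θ f` below the cutoff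
and `g = 0` above it. By the monotone hazard rate `g` is nonnegative and decreasing: below the
cutoff it is the product of `1 - F` and `1 - (1 - c / p) θ f / (1 - F)`, which are both nonnegative
and decreasing. Thus `g` is the tail of a positive multiplier on the participation constraints.
Integrating by parts, the second term is `D(θlo) + ∫ g δ`, and Bonnet's second mean value inequality
bounds it below by `D(θlo) (1 - g(θlo)) ≥ 0`, since `D ≥ 0` up to the cutoff, where the candidate
gives exactly the outside option.

An optimal mechanism has neither loss. The first equality gives its quantities, hence its marginal
rents; the second then forces equal rents; and quantities and rents determine the transfers
(`IsFeasible.ae_transfer_eq`).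
-/

/-! ### Subgradients, and a second mean value inequality -/

/-- A subgradient selection of a function on an interval is monotone. -/
theorem monotoneOn_of_subgradient {U Q : ℝ → ℝ} {s : Set ℝ}
    (h : ∀ x ∈ s, ∀ y ∈ s, U x + (y - x) * Q x ≤ U y) : MonotoneOn Q s := by
  intro x hx y hy hxy
  rcases hxy.eq_or_lt with rfl | hlt
  · exact le_rfl
  have h1 := h x hx y hy
  have h2 := h y hy x hx
  have : (y - x) * Q x ≤ (y - x) * Q y := by linarith
  exact le_of_mul_le_mul_left this (by linarith)

/-- A function on a compact interval is the integral of any of its subgradient selections: it is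
Lipschitz, hence absolutely continuous, and a subgradient at a point of differentiability is the
derivative. -/
theorem integral_subgradient {U Q : ℝ → ℝ} {a b : ℝ} (hab : a ≤ b)
    (h : ∀ x ∈ Icc a b, ∀ y ∈ Icc a b, U x + (y - x) * Q x ≤ U y)
    {x : ℝ} (hx : x ∈ Icc a b) : U x = U a + ∫ t in a..x, Q t := by
  have hmono := monotoneOn_of_subgradient h
  have ha : a ∈ Icc a b := left_mem_Icc.2 hab
  have hb : b ∈ Icc a b := right_mem_Icc.2 hab
  obtain ⟨C, hC0, hC⟩ : ∃ C : ℝ, 0 ≤ C ∧ ∀ x ∈ Icc a b, |Q x| ≤ C := by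
    refine ⟨max |Q a| |Q b|, le_max_of_le_left (abs_nonneg _), fun x hx => ?_⟩
    exact abs_le_max_abs_abs (hmono ha hx hx.1) (hmono hx hb hx.2)
  have hlip : LipschitzOnWith C.toNNReal U (uIcc a b) := by
    rw [uIcc_of_le hab]
    refine LipschitzOnWith.of_dist_le_mul fun x hx y hy => ?_
    rw [Real.dist_eq, Real.dist_eq, Real.coe_toNNReal C hC0]
    have key : ∀ x ∈ Icc a b, ∀ y ∈ Icc a b, U x - U y ≤ C * |x - y| := by
      intro x hx y hy
      have h1 := h x hx y hy
      have h2 : (x - y) * Q x ≤ |x - y| * |Q x| := by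
        rw [← abs_mul]; exact le_abs_self _
      have h3 := mul_le_mul_of_nonneg_left (hC x hx) (abs_nonneg (x - y))
      linarith
    have h1 := key x hx y hy
    have h2 := key y hy x hx
    rw [abs_sub_comm y x] at h2
    exact abs_le.2 ⟨by linarith, h1⟩
  have hac := hlip.absolutelyContinuousOnInterval
  have hQ : IntervalIntegrable Q volume a b := by
    apply MonotoneOn.intervalIntegrable
    rwa [uIcc_of_le hab]
  have hacQ := hQ.absolutelyContinuousOnInterval_intervalIntegral (c := a) (by simp)
  obtain ⟨K, hK⟩ := (hac.sub hacQ).const_of_ae_hasDerivAt_zero (by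
    have h1 : ∀ᵐ x : ℝ, x ≠ a := by simp [ae_iff, measure_singleton]
    have h2 : ∀ᵐ x : ℝ, x ≠ b := by simp [ae_iff, measure_singleton]
    filter_upwards [hac.ae_differentiableAt, hQ.ae_hasDerivAt_integral, h1, h2]
      with x hx1 hx2 hxa hxb hx
    have hd := (hx1 hx).hasDerivAt
    rw [uIcc_of_le hab] at hx
    have hnhds : Icc a b ∈ nhds x :=
      Icc_mem_nhds (lt_of_le_of_ne hx.1 (Ne.symm hxa)) (lt_of_le_of_ne hx.2 hxb)
    -- `y ↦ U y - (y - x) * Q x` has a local minimum at `x`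
    have hmin : IsLocalMin (fun y => U y - (y - x) * Q x) x := by
      filter_upwards [hnhds] with y hy
      have := h x hx y hy
      simp only [sub_self, zero_mul]
      linarith
    have hder : HasDerivAt (fun y => U y - (y - x) * Q x) (deriv U x - 1 * Q x) x :=
      hd.sub (((hasDerivAt_id x).sub_const x).mul_const (Q x))
    have h0 := hmin.hasDerivAt_eq_zero hder
    have hfin := hd.sub (hx2 (by rwa [uIcc_of_le hab]) a (by simp))
    convert! hfin using 1
    linarith)
  rw [uIcc_of_le hab] at hK
  have e1 := hK x hx
  have e2 := hK a ha
  simp only [Pi.sub_apply, intervalIntegral.integral_same] at e1 e2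
  linarith

/-- Bonnet's second mean value inequality: if `g ≥ 0` is decreasing and the primitive of `δ` from
`a` is at least `-d` up to the point from which `g` vanishes, then `∫ g δ ≥ -d g(a)`. The proof
writes `g` as a superposition of indicators of initial intervals. -/
theorem neg_mul_le_integral_antitone_mul {g δ : ℝ → ℝ} {a b c d : ℝ} (hab : a ≤ b)
    (hg : AntitoneOn g (Icc a b)) (hg0 : ∀ x ∈ Icc a b, 0 ≤ g x)
    (hgc : ∀ x ∈ Icc a b, c ≤ x → g x = 0) (hac : a ≤ c)
    (hδ : IntervalIntegrable δ volume a b)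
    (hd : ∀ x ∈ Icc a b, x ≤ c → -d ≤ ∫ t in a..x, δ t) :
    -(d * g a) ≤ ∫ x in a..b, g x * δ x := by
  have ha : a ∈ Icc a b := left_mem_Icc.2 hab
  have hga := hg0 a ha
  set μ := volume.restrict (Ioc a b) with hμ
  set ν := volume.restrict (Ioc 0 (g a)) with hν
  have hδ' : Integrable δ μ := hδ.1
  have hgm : AEMeasurable g μ :=
    aemeasurable_restrict_of_antitoneOn measurableSet_Ioc (hg.mono Ioc_subset_Icc_self)
  -- measurable representative of `g`
  set g' := hgm.mk g with hg'
  have hg'm : Measurable g' := hgm.measurable_mk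
  have hgg' : g =ᵐ[μ] g' := hgm.ae_eq_mk
  have hset : MeasurableSet {x : ℝ × ℝ | x.2 < g' x.1} :=
    measurableSet_lt measurable_snd (hg'm.comp measurable_fst)
  have hint : Integrable (fun x : ℝ × ℝ => {x : ℝ × ℝ | x.2 < g' x.1}.indicator
      (fun x => δ x.1) x) (μ.prod ν) :=
    (hδ'.comp_fst ν).indicator hset
  have e1 : ∫ x in a..b, g x * δ x = ∫ x, ∫ s, {x : ℝ × ℝ | x.2 < g' x.1}.indicator
      (fun x => δ x.1) (x, s) ∂ν ∂μ := by
    rw [intervalIntegral.integral_of_le hab]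
    refine integral_congr_ae ?_
    filter_upwards [hgg', ae_restrict_mem measurableSet_Ioc] with x hx hxm
    have hx1 := hg ha (Ioc_subset_Icc_self hxm) hxm.1.le
    have hx0 := hg0 x (Ioc_subset_Icc_self hxm)
    have : (fun s => {x : ℝ × ℝ | x.2 < g' x.1}.indicator (fun x => δ x.1) (x, s))
        = (Iio (g x)).indicator fun _ => δ x := by
      ext s
      simp only [indicator, mem_ofPred_eq, mem_Iio, hx]
    rw [this, integral_indicator measurableSet_Iio, hν, Measure.restrict_restrict measurableSet_Iio]
    have hs : Iio (g x) ∩ Ioc 0 (g a) = Ioo 0 (g x) := by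
      ext s; simp only [mem_inter_iff, mem_Iio, mem_Ioc, mem_Ioo]
      constructor
      · rintro ⟨h1, h2, h3⟩; exact ⟨h2, h1⟩
      · rintro ⟨h1, h2⟩; exact ⟨h2, h1, by linarith⟩
    rw [hs]
    simp [Measure.real, hx0]
  have hswap := integral_integral_swap (μ := μ) (ν := ν)
    (f := fun x s => {x : ℝ × ℝ | x.2 < g' x.1}.indicator (fun x => δ x.1) (x, s)) hint
  rw [e1, hswap]
  have hlow : ∀ s ∈ Ioc 0 (g a), -d ≤ ∫ x, {x : ℝ × ℝ | x.2 < g' x.1}.indicator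
      (fun x => δ x.1) (x, s) ∂μ := by
    intro s hs
    set T := {x | x ∈ Icc a b ∧ (x = a ∨ s < g x)} with hT
    have hTne : T.Nonempty := ⟨a, ha, Or.inl rfl⟩
    have hTb : BddAbove T := ⟨b, fun x hx => hx.1.2⟩
    set y := sSup T with hy
    have hyI : y ∈ Icc a b := ⟨le_csSup hTb ⟨ha, Or.inl rfl⟩, csSup_le hTne fun x hx => hx.1.2⟩
    have hyc : y ≤ c := by
      refine csSup_le hTne fun x hx => ?_
      rcases hx.2 with rfl | h
      · exact hac
      · by_contra hcx
        have := hgc x hx.1 (not_le.1 hcx).le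
        linarith [hs.1]
    have hne : ∀ᵐ x : ℝ, x ≠ y := by simp [ae_iff, measure_singleton]
    have : ∫ x, {x : ℝ × ℝ | x.2 < g' x.1}.indicator (fun x => δ x.1) (x, s) ∂μ
        = ∫ x, (Iio y).indicator δ x ∂μ := by
      refine integral_congr_ae ?_
      filter_upwards [hgg', ae_restrict_mem measurableSet_Ioc, ae_restrict_of_ae hne]
        with x hx hxm hxy
      simp only [indicator, mem_ofPred_eq, mem_Iio, ← hx]
      have hiff : s < g x ↔ x < y := by
        constructor
        · intro h
          exact lt_of_le_of_ne (le_csSup hTb ⟨Ioc_subset_Icc_self hxm, Or.inr h⟩) hxy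
        · intro h
          obtain ⟨z, hz, hxz⟩ := exists_lt_of_lt_csSup hTne h
          rcases hz.2 with rfl | h'
          · exact absurd hxm.1 (not_lt.2 hxz.le)
          · exact h'.trans_le (hg (Ioc_subset_Icc_self hxm) hz.1 hxz.le)
      simp only [hiff]
    rw [this, integral_indicator measurableSet_Iio, hμ, Measure.restrict_restrict measurableSet_Iio]
    have hs' : Iio y ∩ Ioc a b = Ioo a y := by
      ext z; simp only [mem_inter_iff, mem_Iio, mem_Ioc, mem_Ioo]
      constructor
      · rintro ⟨h1, h2, h3⟩; exact ⟨h2, h1⟩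
      · rintro ⟨h1, h2⟩; exact ⟨h2, h1, by linarith [hyI.2]⟩
    rw [hs', ← integral_Ioc_eq_integral_Ioo, ← intervalIntegral.integral_of_le hyI.1]
    exact hd y hyI hyc
  have hconst : ∫ _ in Ioc 0 (g a), -d = -(d * g a) := by
    simp [Measure.real, hga]; ring
  rw [← hconst]
  refine integral_mono_ae (integrable_const _) hint.integral_prod_right ?_
  filter_upwards [ae_restrict_mem measurableSet_Ioc] with s hs using hlow s hs

/-- Integration by parts for a primitive against the tail of a density. -/
theorem integral_mul_primitive {f δ : ℝ → ℝ} {a b d : ℝ}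
    (hf : IntervalIntegrable f volume a b) (hδ : IntervalIntegrable δ volume a b)
    (hf1 : ∫ x in a..b, f x = 1) :
    ∫ x in a..b, f x * (d + ∫ t in a..x, δ t)
      = d + ∫ x in a..b, (1 - ∫ t in a..x, f t) * δ x := by
  have hF := hf.absolutelyContinuousOnInterval_intervalIntegral (c := a) (by simp)
  have hD := hδ.absolutelyContinuousOnInterval_intervalIntegral (c := a) (by simp)
  have hparts := AbsolutelyContinuousOnInterval.integral_deriv_mul_eq_sub hF hD
  have e : ∫ x in a..b, (f x * (∫ t in a..x, δ t) + (∫ t in a..x, f t) * δ x)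
      = ∫ x in a..b, δ x := by
    rw [hf1] at hparts
    simp only [intervalIntegral.integral_same, mul_zero, one_mul, sub_zero] at hparts
    rw [← hparts]
    refine intervalIntegral.integral_congr_ae ?_
    filter_upwards [hf.ae_hasDerivAt_integral, hδ.ae_hasDerivAt_integral] with x h1 h2 hx
    have hx' := uIoc_subset_uIcc hx
    rw [(h1 hx' a (by simp)).deriv, (h2 hx' a (by simp)).deriv]
  have i1 : IntervalIntegrable (fun x => f x * (∫ t in a..x, δ t)) volume a b :=
    hf.mul_continuousOn hD.continuousOn
  have i2 : IntervalIntegrable (fun x => (∫ t in a..x, f t) * δ x) volume a b :=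
    hδ.continuousOn_mul hF.continuousOn
  rw [intervalIntegral.integral_add i1 i2] at e
  have e2 : ∫ x in a..b, f x * (d + ∫ t in a..x, δ t)
      = d + ∫ x in a..b, f x * (∫ t in a..x, δ t) := by
    simp only [mul_add]
    rw [intervalIntegral.integral_add (hf.mul_const d) i1, intervalIntegral.integral_mul_const, hf1,
      one_mul]
  have e3 : ∫ x in a..b, (1 - ∫ t in a..x, f t) * δ x
      = (∫ x in a..b, δ x) - ∫ x in a..b, (∫ t in a..x, f t) * δ x := by
    simp only [sub_mul, one_mul]
    exact intervalIntegral.integral_sub hδ i2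
  rw [e2, e3]; linarith

/-! ### Power functions -/

/-- Weighted arithmetic-geometric mean inequality, the source of the bound on `v q ^ α - c q`. -/
theorem rpow_mul_rpow_le {α x y : ℝ} (hα : 0 < α) (hα1 : α < 1) (hx : 0 ≤ x) (hy : 0 ≤ y) :
    x ^ (1 - α) * y ^ α ≤ (1 - α) * x + α * y :=
  Real.geom_mean_le_arith_mean2_weighted (by linarith) hα.le hx hy (by ring)

/-- The equality case, which makes optimal quantities unique. -/
theorem eq_of_rpow_mul_rpow_eq {α x y : ℝ} (hα : 0 < α) (hα1 : α < 1) (hx : 0 ≤ x) (hy : 0 ≤ y)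
    (h : x ^ (1 - α) * y ^ α = (1 - α) * x + α * y) : x = y := by
  have := (Real.geom_mean_eq_arith_mean_weighted_iff_of_pos' (Finset.univ : Finset (Fin 2))
    ![1 - α, α] ![x, y] (by intro i _; fin_cases i <;> simp [hα, hα1])
    (by simp) (by intro i _; fin_cases i <;> simp [hx, hy])).1 (by simpa using h)
  have h1 := this 0 (by simp)
  have h2 := this 1 (by simp)
  exact h1.trans h2.symm

/-- The tangent line inequality for the power function `v ↦ v ^ κ / κ`. -/
theorem rpow_tangent_le {κ x y : ℝ} (hκ : 1 < κ) (hx : 0 ≤ x) (hy : 0 ≤ y) :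
    x ^ κ / κ + (y - x) * x ^ (κ - 1) ≤ y ^ κ / κ := by
  have hκ0 : 0 < κ := by linarith
  have h := Real.geom_mean_le_arith_mean2_weighted (w₁ := 1 - 1 / κ) (w₂ := 1 / κ)
    (p₁ := x ^ κ) (p₂ := y ^ κ) (by rw [sub_nonneg, div_le_one hκ0]; exact hκ.le) (by positivity)
    (by positivity) (by positivity) (by ring)
  rw [← Real.rpow_mul hx, ← Real.rpow_mul hy, mul_one_div, div_self hκ0.ne', Real.rpow_one,
    show κ * (1 - 1 / κ) = κ - 1 by field_simp] at h
  have hxx : x ^ κ = x * x ^ (κ - 1) := by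
    rcases hx.eq_or_lt with rfl | hx
    · rw [Real.zero_rpow hκ0.ne', zero_mul]
    · rw [Real.rpow_sub_one hx.ne']; field_simp
  have e : (1 - 1 / κ) * x ^ κ + 1 / κ * y ^ κ = x ^ κ - x ^ κ / κ + y ^ κ / κ := by ring
  rw [e] at h
  nlinarith [h, hxx]

theorem integral_rpow_sub_one {κ a b : ℝ} (hκ : 1 < κ) :
    ∫ x in a..b, x ^ (κ - 1) = b ^ κ / κ - a ^ κ / κ := by
  rw [integral_rpow (Or.inl (by linarith)), sub_add_cancel]; ring

noncomputable section

namespace ServiceMarket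

section

variable (E : ServiceMarket)

/-! ### The laws of signal, shock and value -/

theorem θlo_mem : E.θlo ∈ E.signals := left_mem_Icc.2 E.θlo_lt.le

theorem θhi_mem : E.θhi ∈ E.signals := right_mem_Icc.2 E.θlo_lt.le

theorem signals_nonneg {θ : ℝ} (h : θ ∈ E.signals) : 0 ≤ θ := E.θlo_nonneg.trans h.1

theorem vlo_nonneg : 0 ≤ E.vlo := mul_nonneg E.θlo_nonneg E.zlo_nonneg

theorem zhi_pos : 0 < E.zhi := E.zlo_nonneg.trans_lt E.zlo_lt

theorem θhi_pos : 0 < E.θhi := E.θlo_nonneg.trans_lt E.θlo_lt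

theorem mul_mem_values {θ z : ℝ} (hθ : θ ∈ E.signals) (hz : z ∈ Icc E.zlo E.zhi) :
    θ * z ∈ E.values :=
  ⟨mul_le_mul hθ.1 hz.1 E.zlo_nonneg (E.signals_nonneg hθ),
    mul_le_mul hθ.2 hz.2 (E.zlo_nonneg.trans hz.1) E.θhi_pos.le⟩

theorem vhi_mem : E.vhi ∈ E.values :=
  E.mul_mem_values E.θhi_mem (right_mem_Icc.2 E.zlo_lt.le)

theorem vlo_mem : E.vlo ∈ E.values :=
  E.mul_mem_values E.θlo_mem (left_mem_Icc.2 E.zlo_lt.le)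

theorem vhi_pos : 0 < E.vhi := mul_pos E.θhi_pos E.zhi_pos

theorem values_nonneg {v : ℝ} (h : v ∈ E.values) : 0 ≤ v := E.vlo_nonneg.trans h.1

theorem f_intervalIntegrable : IntervalIntegrable E.f volume E.θlo E.θhi :=
  intervalIntegral.intervalIntegrable_of_integral_ne_zero (by rw [E.f_integral]; exact one_ne_zero)

theorem h_intervalIntegrable : IntervalIntegrable E.h volume E.zlo E.zhi :=
  intervalIntegral.intervalIntegrable_of_integral_ne_zero (by rw [E.h_integral]; exact one_ne_zero)

theorem isProbabilityMeasure_withDensity {a b : ℝ} (hab : a < b) {g : ℝ → ℝ}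
    (hg0 : ∀ x ∈ Icc a b, 0 ≤ g x) (hg1 : ∫ x in a..b, g x = 1) :
    IsProbabilityMeasure
      ((volume.restrict (Icc a b)).withDensity fun x => ENNReal.ofReal (g x)) := by
  constructor
  have hint : IntervalIntegrable g volume a b :=
    intervalIntegral.intervalIntegrable_of_integral_ne_zero (by rw [hg1]; exact one_ne_zero)
  have h' : IntegrableOn g (Icc a b) := (integrableOn_Icc_iff_integrableOn_Ioc (by simp)).2 hint.1
  rw [withDensity_apply _ MeasurableSet.univ, Measure.restrict_univ,
    ← ofReal_integral_eq_lintegral_ofReal h', integral_Icc_eq_integral_Ioc,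
    ← intervalIntegral.integral_of_le hab.le, hg1, ENNReal.ofReal_one]
  filter_upwards [ae_restrict_mem measurableSet_Icc] with x hx using hg0 x hx

instance : IsProbabilityMeasure E.signalLaw :=
  isProbabilityMeasure_withDensity E.θlo_lt (fun x hx => (E.f_pos x hx).le) E.f_integral

instance : IsProbabilityMeasure E.shockLaw :=
  isProbabilityMeasure_withDensity E.zlo_lt E.h_nonneg E.h_integral

theorem signalLaw_absolutelyContinuous : E.signalLaw ≪ volume.restrict (Icc E.θlo E.θhi) :=
  withDensity_absolutelyContinuous _ _

theorem shockLaw_absolutelyContinuous : E.shockLaw ≪ volume.restrict (Icc E.zlo E.zhi) :=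
  withDensity_absolutelyContinuous _ _

theorem ae_mem_signals : ∀ᵐ θ ∂E.signalLaw, θ ∈ E.signals :=
  E.signalLaw_absolutelyContinuous.ae_le (ae_restrict_mem measurableSet_Icc)

theorem ae_mem_shocks : ∀ᵐ z ∂E.shockLaw, z ∈ Icc E.zlo E.zhi :=
  E.shockLaw_absolutelyContinuous.ae_le (ae_restrict_mem measurableSet_Icc)

theorem ae_signalLaw_ne (x : ℝ) : ∀ᵐ θ ∂E.signalLaw, θ ≠ x := by
  refine E.signalLaw_absolutelyContinuous.ae_le (ae_restrict_of_ae ?_)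
  simp [ae_iff, measure_singleton]

theorem ae_shockLaw_ne (x : ℝ) : ∀ᵐ z ∂E.shockLaw, z ≠ x := by
  refine E.shockLaw_absolutelyContinuous.ae_le (ae_restrict_of_ae ?_)
  simp [ae_iff, measure_singleton]

theorem ae_volume_of_ae_signalLaw {P : ℝ → Prop} (h : ∀ᵐ θ ∂E.signalLaw, P θ) :
    ∀ᵐ θ : ℝ, θ ∈ E.signals → P θ := by
  have := (ae_withDensity_iff (E.f_meas.ennreal_ofReal)).1 h
  rw [ae_restrict_iff' measurableSet_Icc] at this
  filter_upwards [this] with θ h hθ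
  exact h hθ (by simpa using E.f_pos θ hθ)

theorem ae_volume_of_ae_shockLaw {P : ℝ → Prop} (h : ∀ᵐ z ∂E.shockLaw, P z) :
    ∀ᵐ z : ℝ, z ∈ Icc E.zlo E.zhi → P z := by
  have := (ae_withDensity_iff (E.h_meas.ennreal_ofReal)).1 h
  rw [ae_restrict_iff' measurableSet_Icc] at this
  have h1 : ∀ᵐ x : ℝ, x ≠ E.zlo := by simp [ae_iff, measure_singleton]
  have h2 : ∀ᵐ x : ℝ, x ≠ E.zhi := by simp [ae_iff, measure_singleton]
  filter_upwards [this, h1, h2] with z h hz1 hz2 hz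
  refine h hz ?_
  simpa using E.h_pos z ⟨lt_of_le_of_ne hz.1 (Ne.symm hz1), lt_of_le_of_ne hz.2 hz2⟩

theorem integral_withDensity_Icc {a b : ℝ} (hab : a ≤ b) {g : ℝ → ℝ} (hgm : Measurable g)
    (hg0 : ∀ x ∈ Icc a b, 0 ≤ g x) (φ : ℝ → ℝ) :
    ∫ x, φ x ∂((volume.restrict (Icc a b)).withDensity fun x => ENNReal.ofReal (g x))
      = ∫ x in a..b, g x * φ x := by
  rw [integral_withDensity_eq_integral_toReal_smul hgm.ennreal_ofReal (by simp),
    intervalIntegral.integral_of_le hab, ← integral_Icc_eq_integral_Ioc]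
  refine integral_congr_ae ?_
  filter_upwards [ae_restrict_mem measurableSet_Icc] with x hx
  rw [ENNReal.toReal_ofReal (hg0 x hx), smul_eq_mul]

theorem integral_signalLaw (φ : ℝ → ℝ) :
    ∫ θ, φ θ ∂E.signalLaw = ∫ θ in E.θlo..E.θhi, E.f θ * φ θ :=
  integral_withDensity_Icc E.θlo_lt.le E.f_meas (fun x hx => (E.f_pos x hx).le) φ

theorem integral_shockLaw (φ : ℝ → ℝ) :
    ∫ z, φ z ∂E.shockLaw = ∫ z in E.zlo..E.zhi, E.h z * φ z :=
  integral_withDensity_Icc E.zlo_lt.le E.h_meas E.h_nonneg φ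

theorem integral_valueLaw (θ : ℝ) {φ : ℝ → ℝ} (hφ : Measurable φ) :
    ∫ v, φ v ∂E.valueLaw θ = ∫ z, φ (θ * z) ∂E.shockLaw :=
  integral_map (measurable_const_mul θ).aemeasurable hφ.aestronglyMeasurable

theorem ae_valueLaw_iff (θ : ℝ) {P : ℝ → Prop} (hP : MeasurableSet {v | P v}) :
    (∀ᵐ v ∂E.valueLaw θ, P v) ↔ ∀ᵐ z ∂E.shockLaw, P (θ * z) :=
  ae_map_iff (measurable_const_mul θ).aemeasurable hP

theorem ae_mem_values {θ : ℝ} (hθ : θ ∈ E.signals) : ∀ᵐ v ∂E.valueLaw θ, v ∈ E.values := by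
  rw [E.ae_valueLaw_iff θ (P := fun v => v ∈ E.values) measurableSet_Icc]
  filter_upwards [E.ae_mem_shocks] with z hz using E.mul_mem_values hθ hz

/-- Functions bounded on the support of a shock are integrable. -/
theorem integrable_shockLaw {φ : ℝ → ℝ} (hφ : Measurable φ) {C : ℝ}
    (hC : ∀ z ∈ Icc E.zlo E.zhi, |φ z| ≤ C) : Integrable φ E.shockLaw :=
  Integrable.of_bound hφ.aestronglyMeasurable C
    (by filter_upwards [E.ae_mem_shocks] with z hz using hC z hz)

/-! ### Pointwise optimal quantities -/

/-- The exponent `1 / (1 - α)`, the elasticity of the quantity with respect to the value. -/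
def κ : ℝ := 1 / (1 - E.α)

/-- The quantity that maximizes `σ v q ^ α - c q`: the virtual value is the fraction `σ` of the
value. Both the benchmark allocation and spot-market demand have this form. -/
def alloc (σ v : ℝ) : ℝ := (E.α / E.c * (v * σ)) ^ E.κ

/-- The coefficient in `alloc σ v ^ α = slope σ * v ^ (κ - 1)`. -/
def slope (σ : ℝ) : ℝ := (E.α / E.c * σ) ^ (E.κ - 1)

/-- The moment `E[z ^ κ]` of the shock. -/
def shockMoment : ℝ := ∫ z, z ^ E.κ ∂E.shockLaw

theorem one_lt_κ : 1 < E.κ := by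
  have h1 := E.α_pos
  have h2 := E.α_lt_one
  rw [κ, lt_div_iff₀ (by linarith)]; linarith

theorem κ_pos : 0 < E.κ := zero_lt_one.trans E.one_lt_κ

theorem κ_mul_α : E.κ * E.α = E.κ - 1 := by
  have h2 := E.α_lt_one
  have : 1 - E.α ≠ 0 := by linarith
  rw [κ]; field_simp; ring

theorem κ_mul_one_sub_α : E.κ * (1 - E.α) = 1 := by
  have := E.κ_mul_α
  linarith

theorem alloc_nonneg {σ v : ℝ} (hσ : 0 ≤ σ) (hv : 0 ≤ v) : 0 ≤ E.alloc σ v :=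
  Real.rpow_nonneg (mul_nonneg (div_nonneg E.α_pos.le E.c_pos.le) (mul_nonneg hv hσ)) _

theorem slope_nonneg {σ : ℝ} (hσ : 0 ≤ σ) : 0 ≤ E.slope σ :=
  Real.rpow_nonneg (mul_nonneg (div_nonneg E.α_pos.le E.c_pos.le) hσ) _

theorem slope_mono {σ τ : ℝ} (hσ : 0 ≤ σ) (h : σ ≤ τ) : E.slope σ ≤ E.slope τ := by
  have h0 : 0 ≤ E.α / E.c := div_nonneg E.α_pos.le E.c_pos.le
  exact Real.rpow_le_rpow (mul_nonneg h0 hσ) (mul_le_mul_of_nonneg_left h h0)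
    (by linarith [E.one_lt_κ])

theorem alloc_rpow {σ v : ℝ} (hσ : 0 ≤ σ) (hv : 0 ≤ v) :
    E.alloc σ v ^ E.α = E.slope σ * v ^ (E.κ - 1) := by
  have h0 : 0 ≤ E.α / E.c := div_nonneg E.α_pos.le E.c_pos.le
  rw [alloc, slope, ← Real.rpow_mul (mul_nonneg h0 (mul_nonneg hv hσ)), E.κ_mul_α,
    ← Real.mul_rpow (mul_nonneg h0 hσ) hv]
  congr 1; ring

theorem mul_rpow_κ_sub_one {v : ℝ} (hv : 0 ≤ v) : v * v ^ (E.κ - 1) = v ^ E.κ := by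
  rcases hv.eq_or_lt with rfl | hv
  · rw [zero_mul, Real.zero_rpow E.κ_pos.ne']
  · rw [Real.rpow_sub_one hv.ne']; field_simp

theorem alloc_injOn {σ τ v : ℝ} (hσ : 0 ≤ σ) (hτ : 0 ≤ τ) (hv : 0 < v)
    (h : E.alloc σ v = E.alloc τ v) : σ = τ := by
  have h0 : 0 < E.α / E.c := div_pos E.α_pos E.c_pos
  have := (Real.rpow_left_inj (by positivity) (by positivity) E.κ_pos.ne').1 h
  exact mul_left_cancel₀ hv.ne' (mul_left_cancel₀ h0.ne' this)

theorem alloc_optimal_aux {σ v q : ℝ} (hσ : 0 ≤ σ) (hv : 0 ≤ v) :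
    E.α * (σ * v * q ^ E.α) = E.c * (E.alloc σ v ^ (1 - E.α) * q ^ E.α) := by
  have h0 : 0 ≤ E.α / E.c := div_nonneg E.α_pos.le E.c_pos.le
  have hc := E.c_pos.ne'
  rw [alloc, ← Real.rpow_mul (mul_nonneg h0 (mul_nonneg hv hσ)), E.κ_mul_one_sub_α, Real.rpow_one]
  field_simp

theorem alloc_rpow_mul {σ v : ℝ} (hσ : 0 ≤ σ) (hv : 0 ≤ v) :
    E.alloc σ v ^ (1 - E.α) * E.alloc σ v ^ E.α = E.alloc σ v := by
  rw [← Real.rpow_add_of_nonneg (E.alloc_nonneg hσ hv) (by linarith [E.α_lt_one]) E.α_pos.le]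
  simp

/-- `alloc σ v` maximizes `σ v q ^ α - c q`. -/
theorem le_alloc {σ v q : ℝ} (hσ : 0 ≤ σ) (hv : 0 ≤ v) (hq : 0 ≤ q) :
    σ * v * q ^ E.α - E.c * q ≤ σ * v * E.alloc σ v ^ E.α - E.c * E.alloc σ v := by
  have h1 := E.alloc_optimal_aux (q := q) hσ hv
  have h2 := E.alloc_optimal_aux (q := E.alloc σ v) hσ hv
  rw [E.alloc_rpow_mul hσ hv] at h2
  have h3 := rpow_mul_rpow_le E.α_pos E.α_lt_one (E.alloc_nonneg hσ hv) hq
  refine le_of_mul_le_mul_left ?_ E.α_pos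
  have h4 := mul_le_mul_of_nonneg_left h3 E.c_pos.le
  nlinarith

/-- `alloc σ v` is the only maximizer of `σ v q ^ α - c q`. -/
theorem eq_alloc {σ v q : ℝ} (hσ : 0 ≤ σ) (hv : 0 ≤ v) (hq : 0 ≤ q)
    (h : σ * v * q ^ E.α - E.c * q = σ * v * E.alloc σ v ^ E.α - E.c * E.alloc σ v) :
    q = E.alloc σ v := by
  have h1 := E.alloc_optimal_aux (q := q) hσ hv
  have h2 := E.alloc_optimal_aux (q := E.alloc σ v) hσ hv
  rw [E.alloc_rpow_mul hσ hv] at h2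
  refine (eq_of_rpow_mul_rpow_eq E.α_pos E.α_lt_one (E.alloc_nonneg hσ hv) hq ?_).symm
  refine mul_left_cancel₀ E.c_pos.ne' ?_
  have h4 := congrArg (fun x => E.α * x) h
  beta_reduce at h4
  linarith

theorem integrable_rpow_shock {r : ℝ} (hr : 0 ≤ r) : Integrable (fun z => z ^ r) E.shockLaw := by
  refine E.integrable_shockLaw (by fun_prop) (C := E.zhi ^ r) fun z hz => ?_
  have hz0 := E.zlo_nonneg.trans hz.1
  rw [abs_of_nonneg (Real.rpow_nonneg hz0 _)]
  exact Real.rpow_le_rpow hz0 hz.2 hr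

theorem shockMoment_nonneg : 0 ≤ E.shockMoment :=
  integral_nonneg_of_ae (by
    filter_upwards [E.ae_mem_shocks] with z hz using Real.rpow_nonneg (E.zlo_nonneg.trans hz.1) _)

theorem integral_shock_mul_rpow {θ : ℝ} (hθ : 0 ≤ θ) :
    ∫ z, (θ * z) ^ E.κ ∂E.shockLaw = θ ^ E.κ * E.shockMoment := by
  rw [shockMoment, ← integral_const_mul]
  refine integral_congr_ae ?_
  filter_upwards [E.ae_mem_shocks] with z hz
  exact Real.mul_rpow hθ (E.zlo_nonneg.trans hz.1)

/-- The marginal interim rent `E[z q ^ α ∣ θ]` of the allocation `alloc σ`. -/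
def rentRate (σ : ℝ → ℝ) (x : ℝ) : ℝ := E.shockMoment * (E.slope (σ x) * x ^ (E.κ - 1))

theorem integral_shock_mul_alloc {σ θ : ℝ} (hσ : 0 ≤ σ) (hθ : 0 ≤ θ) :
    ∫ z, z * E.alloc σ (θ * z) ^ E.α ∂E.shockLaw
      = E.shockMoment * (E.slope σ * θ ^ (E.κ - 1)) := by
  rw [shockMoment, ← integral_mul_const]
  refine integral_congr_ae ?_
  filter_upwards [E.ae_mem_shocks] with z hz
  have hz0 := E.zlo_nonneg.trans hz.1
  rw [E.alloc_rpow hσ (mul_nonneg hθ hz0), Real.mul_rpow hθ hz0, ← E.mul_rpow_κ_sub_one hz0]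
  ring

theorem monotoneOn_rentRate {σ : ℝ → ℝ} (hσ0 : ∀ x ∈ E.signals, 0 ≤ σ x)
    (hσ : MonotoneOn σ E.signals) : MonotoneOn (E.rentRate σ) E.signals := by
  intro x hx y hy hxy
  refine mul_le_mul_of_nonneg_left ?_ E.shockMoment_nonneg
  exact mul_le_mul (E.slope_mono (hσ0 x hx) (hσ hx hy hxy))
    (Real.rpow_le_rpow (E.signals_nonneg hx) hxy (by linarith [E.one_lt_κ]))
    (Real.rpow_nonneg (E.signals_nonneg hx) _) (E.slope_nonneg (hσ0 y hy))

theorem rentRate_mono {σ τ : ℝ → ℝ} {x : ℝ} (hx : 0 ≤ x) (hσ : 0 ≤ σ x) (h : σ x ≤ τ x) :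
    E.rentRate σ x ≤ E.rentRate τ x :=
  mul_le_mul_of_nonneg_left (mul_le_mul_of_nonneg_right (E.slope_mono hσ h)
    (Real.rpow_nonneg hx _)) E.shockMoment_nonneg

theorem intervalIntegrable_of_monotoneOn {Q : ℝ → ℝ} (hQ : MonotoneOn Q E.signals) {x y : ℝ}
    (hx : x ∈ E.signals) (hy : y ∈ E.signals) : IntervalIntegrable Q volume x y :=
  (hQ.mono (ordConnected_Icc.uIcc_subset hx hy)).intervalIntegrable

end

section

variable (E : ServiceMarket)

/-! ### Reduced form of feasible mechanisms -/

/-- The truthful ex-post payoff of signal `θ` and value `v`. -/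
def expostPayoff (q t : ℝ → ℝ → ℝ) (θ v : ℝ) : ℝ := E.payoff v (q θ v) (t θ v)

/-- `E[z q ^ α ∣ θ]`, the marginal interim rent. -/
def marginalRent (q : ℝ → ℝ → ℝ) (θ : ℝ) : ℝ := ∫ z, z * q θ (θ * z) ^ E.α ∂E.shockLaw

/-- `E[q ∣ θ]`. -/
def expectedQuantity (q : ℝ → ℝ → ℝ) (θ : ℝ) : ℝ := ∫ z, q θ (θ * z) ∂E.shockLaw

/-- The truthful interim utility. -/
def rent (q t : ℝ → ℝ → ℝ) (θ : ℝ) : ℝ := E.interimUtility q t θ θ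

variable {E} {p : ℝ} {q t : ℝ → ℝ → ℝ}

theorem payoff_subgradient (h : E.IC1 q t) {θ : ℝ} (hθ : θ ∈ E.signals) :
    ∀ v ∈ E.values, ∀ v' ∈ E.values,
      E.expostPayoff q t θ v + (v' - v) * q θ v ^ E.α ≤ E.expostPayoff q t θ v' := by
  intro v hv v' hv'
  have := h θ hθ v' hv' v hv
  simp only [expostPayoff, payoff] at this ⊢
  linarith

namespace IsFeasible

theorem measurable_q (hf : E.IsFeasible p q t) (θ : ℝ) : Measurable (q θ) :=
  hf.q_meas.comp measurable_prodMk_left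

theorem measurable_t (hf : E.IsFeasible p q t) (θ : ℝ) : Measurable (t θ) :=
  hf.t_meas.comp measurable_prodMk_left

theorem measurable_expostPayoff (hf : E.IsFeasible p q t) (θ : ℝ) :
    Measurable (E.expostPayoff q t θ) :=
  (measurable_id.mul ((hf.measurable_q θ).pow_const _)).sub (hf.measurable_t θ)

theorem rpow_monotoneOn (hf : E.IsFeasible p q t) {θ : ℝ} (hθ : θ ∈ E.signals) :
    MonotoneOn (fun v => q θ v ^ E.α) E.values :=
  monotoneOn_of_subgradient (payoff_subgradient hf.ic1 hθ)

theorem q_le (hf : E.IsFeasible p q t) {θ v : ℝ} (hθ : θ ∈ E.signals) (hv : v ∈ E.values) :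
    q θ v ≤ q θ E.vhi :=
  (Real.rpow_le_rpow_iff (hf.q_nonneg θ hθ v hv) (hf.q_nonneg θ hθ _ E.vhi_mem) E.α_pos).1
    (hf.rpow_monotoneOn hθ hv E.vhi_mem hv.2)

theorem expostPayoff_monotoneOn (hf : E.IsFeasible p q t) {θ : ℝ} (hθ : θ ∈ E.signals) :
    MonotoneOn (E.expostPayoff q t θ) E.values := by
  intro v hv v' hv' h
  have h1 := payoff_subgradient hf.ic1 hθ v hv v' hv'
  have h2 : 0 ≤ (v' - v) * q θ v ^ E.α :=
    mul_nonneg (by linarith) (Real.rpow_nonneg (hf.q_nonneg θ hθ v hv) _)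
  linarith

theorem integrable_expostPayoff (hf : E.IsFeasible p q t) {θ x : ℝ} (hθ : θ ∈ E.signals)
    (hx : x ∈ E.signals) : Integrable (fun z => E.expostPayoff q t θ (x * z)) E.shockLaw := by
  refine E.integrable_shockLaw ((hf.measurable_expostPayoff θ).comp (measurable_const_mul x))
    (C := max |E.expostPayoff q t θ E.vlo| |E.expostPayoff q t θ E.vhi|) fun z hz => ?_
  have hv := E.mul_mem_values hx hz
  exact abs_le_max_abs_abs (hf.expostPayoff_monotoneOn hθ E.vlo_mem hv hv.1)
    (hf.expostPayoff_monotoneOn hθ hv E.vhi_mem hv.2)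

theorem integrable_rpow (hf : E.IsFeasible p q t) {θ : ℝ} (hθ : θ ∈ E.signals) :
    Integrable (fun z => z * q θ (θ * z) ^ E.α) E.shockLaw := by
  refine E.integrable_shockLaw (measurable_id.mul
    (((hf.measurable_q θ).comp (measurable_const_mul θ)).pow_const _))
    (C := E.zhi * q θ E.vhi ^ E.α) fun z hz => ?_
  have hv := E.mul_mem_values hθ hz
  have hz0 := E.zlo_nonneg.trans hz.1
  have h0 := Real.rpow_nonneg (hf.q_nonneg θ hθ _ hv) E.α
  rw [abs_of_nonneg (mul_nonneg hz0 h0)]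
  exact mul_le_mul hz.2 (hf.rpow_monotoneOn hθ hv E.vhi_mem hv.2) h0 E.zhi_pos.le

theorem integrable_q (hf : E.IsFeasible p q t) {θ : ℝ} (hθ : θ ∈ E.signals) :
    Integrable (fun z => q θ (θ * z)) E.shockLaw := by
  refine E.integrable_shockLaw ((hf.measurable_q θ).comp (measurable_const_mul θ))
    (C := q θ E.vhi) fun z hz => ?_
  have hv := E.mul_mem_values hθ hz
  rw [abs_of_nonneg (hf.q_nonneg θ hθ _ hv)]
  exact hf.q_le hθ hv

theorem interimUtility_eq (hf : E.IsFeasible p q t) (θ θ' : ℝ) :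
    E.interimUtility q t θ θ' = ∫ z, E.expostPayoff q t θ' (θ * z) ∂E.shockLaw :=
  E.integral_valueLaw θ (hf.measurable_expostPayoff θ')

/-- Since `v = θ z`, the ex-post subgradient inequality passes to interim utilities. -/
theorem rent_subgradient (hf : E.IsFeasible p q t) :
    ∀ θ ∈ E.signals, ∀ θ' ∈ E.signals,
      E.rent q t θ + (θ' - θ) * E.marginalRent q θ ≤ E.rent q t θ' := by
  intro θ hθ θ' hθ'
  refine le_trans ?_ (hf.ic0 θ' hθ' θ hθ)
  rw [rent, hf.interimUtility_eq, hf.interimUtility_eq, marginalRent, ← integral_const_mul,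
    ← integral_add (hf.integrable_expostPayoff hθ hθ) ((hf.integrable_rpow hθ).const_mul _)]
  refine integral_mono_ae ((hf.integrable_expostPayoff hθ hθ).add
    ((hf.integrable_rpow hθ).const_mul _)) (hf.integrable_expostPayoff hθ hθ') ?_
  filter_upwards [E.ae_mem_shocks] with z hz
  have := payoff_subgradient hf.ic1 hθ _ (E.mul_mem_values hθ hz) _ (E.mul_mem_values hθ' hz)
  refine le_trans (le_of_eq ?_) this
  ring

theorem marginalRent_monotoneOn (hf : E.IsFeasible p q t) :
    MonotoneOn (E.marginalRent q) E.signals :=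
  monotoneOn_of_subgradient hf.rent_subgradient

/-- The envelope formula for interim utilities. -/
theorem rent_eq (hf : E.IsFeasible p q t) {θ : ℝ} (hθ : θ ∈ E.signals) :
    E.rent q t θ = E.rent q t E.θlo + ∫ x in E.θlo..θ, E.marginalRent q x :=
  integral_subgradient E.θlo_lt.le hf.rent_subgradient hθ

/-- Expected profit from signal `θ`: surplus less rent. -/
theorem integral_profit_eq (hf : E.IsFeasible p q t) {θ : ℝ} (hθ : θ ∈ E.signals) :
    ∫ z, (t θ (θ * z) - E.c * q θ (θ * z)) ∂E.shockLaw
      = θ * E.marginalRent q θ - E.rent q t θ - E.c * E.expectedQuantity q θ := by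
  have i1 : Integrable (fun z => θ * (z * q θ (θ * z) ^ E.α) - E.expostPayoff q t θ (θ * z))
      E.shockLaw := ((hf.integrable_rpow hθ).const_mul _).sub (hf.integrable_expostPayoff hθ hθ)
  rw [rent, hf.interimUtility_eq, marginalRent, expectedQuantity, ← integral_const_mul,
    ← integral_const_mul, ← integral_sub ((hf.integrable_rpow hθ).const_mul _)
      (hf.integrable_expostPayoff hθ hθ), ← integral_sub i1 ((hf.integrable_q hθ).const_mul _)]
  refine integral_congr_ae (Filter.Eventually.of_forall fun z => ?_)
  simp only [expostPayoff, payoff]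
  ring

theorem integrable_profit_prod (hf : E.IsFeasible p q t) :
    Integrable (fun x : ℝ × ℝ => t x.1 (x.1 * x.2) - E.c * q x.1 (x.1 * x.2))
      (E.signalLaw.prod E.shockLaw) :=
  hf.profit_integrable.comp_measurable (by fun_prop)

theorem integrable_profit (hf : E.IsFeasible p q t) :
    Integrable (fun θ => θ * E.marginalRent q θ - E.rent q t θ - E.c * E.expectedQuantity q θ)
      E.signalLaw :=
  hf.integrable_profit_prod.integral_prod_left.congr (by
    filter_upwards [E.ae_mem_signals] with θ hθ using hf.integral_profit_eq hθ)

theorem profit_eq (hf : E.IsFeasible p q t) :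
    E.profit q t = ∫ θ, (θ * E.marginalRent q θ - E.rent q t θ - E.c * E.expectedQuantity q θ)
      ∂E.signalLaw := by
  have h : E.profit q t = ∫ x : ℝ × ℝ, (t x.1 (x.1 * x.2) - E.c * q x.1 (x.1 * x.2))
      ∂(E.signalLaw.prod E.shockLaw) :=
    integral_map (by fun_prop) hf.profit_integrable.aestronglyMeasurable
  rw [h, integral_prod _ hf.integrable_profit_prod]
  refine integral_congr_ae ?_
  filter_upwards [E.ae_mem_signals] with θ hθ using hf.integral_profit_eq hθ

theorem integral_virtualSurplus (hf : E.IsFeasible p q t) {θ : ℝ} (hθ : θ ∈ E.signals) (σ : ℝ) :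
    Integrable (fun z => σ * (θ * z) * q θ (θ * z) ^ E.α - E.c * q θ (θ * z)) E.shockLaw ∧
    ∫ z, (σ * (θ * z) * q θ (θ * z) ^ E.α - E.c * q θ (θ * z)) ∂E.shockLaw
      = σ * θ * E.marginalRent q θ - E.c * E.expectedQuantity q θ := by
  have e : (fun z => σ * (θ * z) * q θ (θ * z) ^ E.α - E.c * q θ (θ * z))
      = fun z => σ * θ * (z * q θ (θ * z) ^ E.α) - E.c * q θ (θ * z) := by
    ext z; ring
  rw [e, marginalRent, expectedQuantity, ← integral_const_mul, ← integral_const_mul,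
    ← integral_sub ((hf.integrable_rpow hθ).const_mul _) ((hf.integrable_q hθ).const_mul _)]
  exact ⟨((hf.integrable_rpow hθ).const_mul _).sub ((hf.integrable_q hθ).const_mul _), rfl⟩

variable {q' t' : ℝ → ℝ → ℝ}

/-- Allocations of the form `alloc` maximize the virtual surplus from each signal. -/
theorem virtualSurplus_le (hf : E.IsFeasible p q t) (hf' : E.IsFeasible p q' t') {θ σ : ℝ}
    (hθ : θ ∈ E.signals) (hσ : 0 ≤ σ) (hq' : ∀ v ∈ E.values, q' θ v = E.alloc σ v) :
    σ * θ * E.marginalRent q θ - E.c * E.expectedQuantity q θ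
      ≤ σ * θ * E.marginalRent q' θ - E.c * E.expectedQuantity q' θ := by
  obtain ⟨i1, e1⟩ := hf.integral_virtualSurplus hθ σ
  obtain ⟨i2, e2⟩ := hf'.integral_virtualSurplus hθ σ
  rw [← e1, ← e2]
  refine integral_mono_ae i1 i2 ?_
  filter_upwards [E.ae_mem_shocks] with z hz
  have hv := E.mul_mem_values hθ hz
  rw [hq' _ hv]
  exact E.le_alloc hσ (E.values_nonneg hv) (hf.q_nonneg θ hθ _ hv)

/-- Allocations of the form `alloc` are the only maximizers of the virtual surplus. -/
theorem ae_eq_alloc (hf : E.IsFeasible p q t) (hf' : E.IsFeasible p q' t') {θ σ : ℝ}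
    (hθ : θ ∈ E.signals) (hσ : 0 ≤ σ) (hq' : ∀ v ∈ E.values, q' θ v = E.alloc σ v)
    (h : σ * θ * E.marginalRent q θ - E.c * E.expectedQuantity q θ
      = σ * θ * E.marginalRent q' θ - E.c * E.expectedQuantity q' θ) :
    ∀ᵐ z ∂E.shockLaw, q θ (θ * z) = E.alloc σ (θ * z) := by
  obtain ⟨i1, e1⟩ := hf.integral_virtualSurplus hθ σ
  obtain ⟨i2, e2⟩ := hf'.integral_virtualSurplus hθ σ
  have hz := (integral_eq_iff_of_ae_le i1 i2 (by
    filter_upwards [E.ae_mem_shocks] with z hz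
    have hv := E.mul_mem_values hθ hz
    rw [hq' _ hv]
    exact E.le_alloc hσ (E.values_nonneg hv) (hf.q_nonneg θ hθ _ hv))).1 (by rw [e1, e2, h])
  filter_upwards [hz, E.ae_mem_shocks] with z hz hzm
  have hv := E.mul_mem_values hθ hzm
  rw [hq' _ hv] at hz
  exact E.eq_alloc hσ (E.values_nonneg hv) (hf.q_nonneg θ hθ _ hv) hz

end IsFeasible

end

section

variable (E : ServiceMarket)

/-! ### Mechanisms with linear virtual values -/

/-- Projection of the line onto the signals. -/
def clamp (θ : ℝ) : ℝ := max E.θlo (min θ E.θhi)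

/-- The interim rent with value `u` at the lowest signal that the allocation `alloc σ` leaves. -/
def envelopeRent (σ : ℝ → ℝ) (u θ : ℝ) : ℝ := u + ∫ x in E.θlo..θ, E.rentRate σ x

/-- The allocation that treats the fraction `σ θ` of the value as the virtual value. Off the
signals it is extended so as to be measurable. -/
def mechQ (σ : ℝ → ℝ) (θ v : ℝ) : ℝ := E.alloc (σ (E.clamp θ)) v

/-- The transfers that implement `mechQ σ` with interim rent `envelopeRent σ u`. -/
def mechT (σ : ℝ → ℝ) (u θ v : ℝ) : ℝ :=
  v * E.mechQ σ θ v ^ E.α - (E.envelopeRent σ u (E.clamp θ) +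
    E.slope (σ (E.clamp θ)) * (v ^ E.κ - E.clamp θ ^ E.κ * E.shockMoment) / E.κ)

theorem clamp_mem (θ : ℝ) : E.clamp θ ∈ E.signals :=
  ⟨le_max_left _ _, max_le E.θlo_lt.le (min_le_right _ _)⟩

theorem clamp_of_mem {θ : ℝ} (hθ : θ ∈ E.signals) : E.clamp θ = θ := by
  rw [clamp, min_eq_left hθ.2, max_eq_right hθ.1]

theorem continuous_clamp : Continuous E.clamp := by unfold clamp; fun_prop

theorem clamp_mono : Monotone E.clamp := fun _ _ h => max_le_max_left _ (min_le_min_right _ h)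

theorem mechQ_eq {σ : ℝ → ℝ} {θ : ℝ} (hθ : θ ∈ E.signals) (v : ℝ) :
    E.mechQ σ θ v = E.alloc (σ θ) v := by rw [mechQ, E.clamp_of_mem hθ]

theorem mechT_eq {σ : ℝ → ℝ} {u θ : ℝ} (hθ : θ ∈ E.signals) (v : ℝ) :
    E.mechT σ u θ v = v * E.alloc (σ θ) v ^ E.α - (E.envelopeRent σ u θ +
      E.slope (σ θ) * (v ^ E.κ - θ ^ E.κ * E.shockMoment) / E.κ) := by
  rw [mechT, E.mechQ_eq hθ, E.clamp_of_mem hθ]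

theorem payoff_mech {σ : ℝ → ℝ} {u θ : ℝ} (hθ : θ ∈ E.signals) (v : ℝ) :
    E.payoff v (E.mechQ σ θ v) (E.mechT σ u θ v) = E.envelopeRent σ u θ +
      E.slope (σ θ) * (v ^ E.κ - θ ^ E.κ * E.shockMoment) / E.κ := by
  rw [payoff, E.mechQ_eq hθ, E.mechT_eq hθ]; ring

variable {E} {σ : ℝ → ℝ} {u : ℝ}

theorem continuousOn_envelopeRent (hσ0 : ∀ θ ∈ E.signals, 0 ≤ σ θ)
    (hσ : MonotoneOn σ E.signals) : ContinuousOn (E.envelopeRent σ u) E.signals := by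
  refine continuousOn_const.add ?_
  have := intervalIntegral.continuousOn_primitive_interval'
    (E.intervalIntegrable_of_monotoneOn (E.monotoneOn_rentRate hσ0 hσ) E.θlo_mem E.θhi_mem)
    left_mem_uIcc
  rwa [uIcc_of_le E.θlo_lt.le] at this

theorem envelopeRent_sub (hσ0 : ∀ θ ∈ E.signals, 0 ≤ σ θ) (hσ : MonotoneOn σ E.signals)
    {x y : ℝ} (hx : x ∈ E.signals) (hy : y ∈ E.signals) :
    E.envelopeRent σ u y = E.envelopeRent σ u x + ∫ s in x..y, E.rentRate σ s := by
  have hi := fun {x y} => E.intervalIntegrable_of_monotoneOn (E.monotoneOn_rentRate hσ0 hσ) (x := x)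
    (y := y)
  rw [envelopeRent, envelopeRent, add_assoc, intervalIntegral.integral_add_adjacent_intervals
    (hi E.θlo_mem hx) (hi hx hy)]

theorem measurable_mechQ (hσ : MonotoneOn σ E.signals) :
    Measurable (Function.uncurry (E.mechQ σ)) := by
  have h1 : Measurable fun θ => σ (E.clamp θ) :=
    Monotone.measurable fun x y h => hσ (E.clamp_mem x) (E.clamp_mem y) (E.clamp_mono h)
  have h2 : Measurable fun x : ℝ × ℝ => σ (E.clamp x.1) := h1.comp measurable_fst
  have e : Function.uncurry (E.mechQ σ) =
    fun x : ℝ × ℝ => (E.α / E.c * (x.2 * σ (E.clamp x.1))) ^ E.κ := rfl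
  rw [e]
  exact ((measurable_snd.mul h2).const_mul _).pow_const _

theorem measurable_mechT (hσ0 : ∀ θ ∈ E.signals, 0 ≤ σ θ) (hσ : MonotoneOn σ E.signals) :
    Measurable (Function.uncurry (E.mechT σ u)) := by
  have h1 : Measurable fun θ => σ (E.clamp θ) :=
    Monotone.measurable fun x y h => hσ (E.clamp_mem x) (E.clamp_mem y) (E.clamp_mono h)
  have h2 : Measurable fun x : ℝ × ℝ => σ (E.clamp x.1) := h1.comp measurable_fst
  have h3 : Continuous fun θ => E.envelopeRent σ u (E.clamp θ) :=
    (continuousOn_envelopeRent hσ0 hσ).comp_continuous E.continuous_clamp E.clamp_mem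
  have h4 : Measurable fun x : ℝ × ℝ => E.envelopeRent σ u (E.clamp x.1) :=
    h3.measurable.comp measurable_fst
  have h5 : Measurable fun x : ℝ × ℝ => E.clamp x.1 := E.continuous_clamp.measurable.comp
    measurable_fst
  have h6 : Measurable fun x : ℝ × ℝ => E.mechQ σ x.1 x.2 := measurable_mechQ hσ
  have e : Function.uncurry (E.mechT σ u) = fun x : ℝ × ℝ =>
    x.2 * E.mechQ σ x.1 x.2 ^ E.α - (E.envelopeRent σ u (E.clamp x.1) +
    (E.α / E.c * σ (E.clamp x.1)) ^ (E.κ - 1) *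
      (x.2 ^ E.κ - E.clamp x.1 ^ E.κ * E.shockMoment) / E.κ) := rfl
  rw [e]
  exact (measurable_snd.mul (h6.pow_const _)).sub (h4.add ((((h2.const_mul _).pow_const _).mul
    ((measurable_snd.pow_const _).sub ((h5.pow_const _).mul_const _))).div_const _))

theorem ic1_mech (hσ0 : ∀ θ ∈ E.signals, 0 ≤ σ θ) : E.IC1 (E.mechQ σ) (E.mechT σ u) := by
  intro θ hθ v hv v' hv'
  have h1 := E.payoff_mech (σ := σ) (u := u) hθ v
  have h2 := E.payoff_mech (σ := σ) (u := u) hθ v'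
  have h3 : E.payoff v (E.mechQ σ θ v') (E.mechT σ u θ v')
      = E.payoff v' (E.mechQ σ θ v') (E.mechT σ u θ v') + (v - v') * E.mechQ σ θ v' ^ E.α := by
    simp only [payoff]; ring
  rw [h3, h1, h2, E.mechQ_eq hθ, E.alloc_rpow (hσ0 θ hθ) (E.values_nonneg hv')]
  have h4 := mul_le_mul_of_nonneg_left
    (rpow_tangent_le E.one_lt_κ (E.values_nonneg hv') (E.values_nonneg hv))
    (E.slope_nonneg (hσ0 θ hθ))
  have e : ∀ x y : ℝ, E.slope (σ θ) * (x - y) / E.κ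
      = E.slope (σ θ) * (x / E.κ) - E.slope (σ θ) * (y / E.κ) := fun x y => by ring
  rw [e, e]
  linarith

theorem interimUtility_mech {θ θ' : ℝ} (hθ : θ ∈ E.signals) (hθ' : θ' ∈ E.signals) :
    E.interimUtility (E.mechQ σ) (E.mechT σ u) θ θ' = E.envelopeRent σ u θ' +
      E.slope (σ θ') * (θ ^ E.κ * E.shockMoment - θ' ^ E.κ * E.shockMoment) / E.κ := by
  have hκ := E.κ_pos
  rw [interimUtility]
  simp only [E.payoff_mech hθ']
  rw [E.integral_valueLaw θ (by fun_prop)]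
  have hi : Integrable (fun z => (θ * z) ^ E.κ) E.shockLaw := by
    refine ((E.integrable_rpow_shock hκ.le).const_mul (θ ^ E.κ)).congr ?_
    filter_upwards [E.ae_mem_shocks] with z hz
    exact (Real.mul_rpow (E.signals_nonneg hθ) (E.zlo_nonneg.trans hz.1)).symm
  have hi' : Integrable (fun z => E.slope (σ θ') *
      ((θ * z) ^ E.κ - θ' ^ E.κ * E.shockMoment) / E.κ) E.shockLaw :=
    ((hi.sub (integrable_const _)).const_mul _).div_const _
  rw [integral_add (integrable_const _) hi', integral_div, integral_const_mul,
    integral_sub hi (integrable_const _),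
    E.integral_shock_mul_rpow (E.signals_nonneg hθ)]
  simp

theorem rent_mech {θ : ℝ} (hθ : θ ∈ E.signals) :
    E.rent (E.mechQ σ) (E.mechT σ u) θ = E.envelopeRent σ u θ := by
  rw [rent, interimUtility_mech hθ hθ]; simp

theorem integral_rentRate_const (τ x y : ℝ) :
    ∫ s in x..y, E.rentRate (fun _ => τ) s
      = E.slope τ * (y ^ E.κ * E.shockMoment - x ^ E.κ * E.shockMoment) / E.κ := by
  simp only [rentRate]
  rw [intervalIntegral.integral_const_mul, intervalIntegral.integral_const_mul,
    integral_rpow_sub_one E.one_lt_κ]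
  ring

theorem ic0_mech (hσ0 : ∀ θ ∈ E.signals, 0 ≤ σ θ) (hσ : MonotoneOn σ E.signals) :
    E.IC0 (E.mechQ σ) (E.mechT σ u) := by
  intro θ hθ θ' hθ'
  change _ ≤ E.rent _ _ θ
  rw [rent_mech hθ, interimUtility_mech hθ hθ', envelopeRent_sub hσ0 hσ hθ' hθ,
    ← integral_rentRate_const]
  have hm := E.monotoneOn_rentRate hσ0 hσ
  have hm' := E.monotoneOn_rentRate (σ := fun _ => σ θ') (fun _ _ => hσ0 θ' hθ')
    monotoneOn_const
  gcongr
  rcases le_total θ' θ with h | h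
  · refine intervalIntegral.integral_mono_on h (E.intervalIntegrable_of_monotoneOn hm' hθ' hθ)
      (E.intervalIntegrable_of_monotoneOn hm hθ' hθ) fun s hs => ?_
    have hsm : s ∈ E.signals := ⟨hθ'.1.trans hs.1, hs.2.trans hθ.2⟩
    exact E.rentRate_mono (E.signals_nonneg hsm) (hσ0 θ' hθ') (hσ hθ' hsm hs.1)
  · rw [intervalIntegral.integral_symm, intervalIntegral.integral_symm θ θ', neg_le_neg_iff]
    refine intervalIntegral.integral_mono_on h (E.intervalIntegrable_of_monotoneOn hm hθ hθ')
      (E.intervalIntegrable_of_monotoneOn hm' hθ hθ') fun s hs => ?_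
    have hsm : s ∈ E.signals := ⟨hθ.1.trans hs.1, hs.2.trans hθ'.2⟩
    exact E.rentRate_mono (E.signals_nonneg hsm) (hσ0 s hsm) (hσ hsm hθ' hs.2)

theorem integrable_jointLaw {φ : ℝ × ℝ → ℝ} (hφ : Measurable φ) {C : ℝ}
    (hC : ∀ θ ∈ E.signals, ∀ v ∈ E.values, |φ (θ, v)| ≤ C) : Integrable φ E.jointLaw := by
  have hm : Measurable fun x : ℝ × ℝ => (x.1, x.1 * x.2) := by fun_prop
  rw [jointLaw, integrable_map_measure hφ.aestronglyMeasurable hm.aemeasurable]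
  refine Integrable.of_bound (hφ.comp hm).aestronglyMeasurable C ?_
  filter_upwards [Measure.quasiMeasurePreserving_fst.ae E.ae_mem_signals,
    Measure.quasiMeasurePreserving_snd.ae E.ae_mem_shocks] with x hx hz
  exact hC _ hx _ (E.mul_mem_values hx hz)

theorem integrable_profit_mech (hσ0 : ∀ θ ∈ E.signals, 0 ≤ σ θ) (hσ : MonotoneOn σ E.signals) :
    Integrable (fun x : ℝ × ℝ => E.mechT σ u x.1 x.2 - E.c * E.mechQ σ x.1 x.2) E.jointLaw := by
  obtain ⟨B, hB⟩ := isCompact_Icc.exists_bound_of_continuousOn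
    (continuousOn_envelopeRent (u := u) hσ0 hσ)
  have hκ := E.κ_pos
  have hA := E.shockMoment_nonneg
  have hα := E.α_pos
  have hc := E.c_pos
  have hS := hσ0 _ E.θhi_mem
  have hmQ : Measurable fun x : ℝ × ℝ => E.mechQ σ x.1 x.2 := measurable_mechQ hσ
  have hmT : Measurable fun x : ℝ × ℝ => E.mechT σ u x.1 x.2 := measurable_mechT hσ0 hσ
  set M := E.alloc (σ E.θhi) E.vhi with hM
  refine integrable_jointLaw (hmT.sub (hmQ.const_mul _)) (C := E.vhi * M ^ E.α + (B +
    E.slope (σ E.θhi) * (E.vhi ^ E.κ + E.θhi ^ E.κ * E.shockMoment) / E.κ) + E.c * M)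
    fun θ hθ v hv => ?_
  have hv0 := E.values_nonneg hv
  have hθ0 := E.signals_nonneg hθ
  have hs := hσ0 θ hθ
  have hs' := hσ hθ E.θhi_mem hθ.2
  have hq0 : 0 ≤ E.alloc (σ θ) v := E.alloc_nonneg hs hv0
  have hqM : E.alloc (σ θ) v ≤ M := by
    refine Real.rpow_le_rpow (by positivity) ?_ hκ.le
    exact mul_le_mul_of_nonneg_left (mul_le_mul hv.2 hs' hs E.vhi_pos.le) (by positivity)
  have h1 : 0 ≤ v * E.alloc (σ θ) v ^ E.α := by positivity
  have h2 : v * E.alloc (σ θ) v ^ E.α ≤ E.vhi * M ^ E.α :=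
    mul_le_mul hv.2 (Real.rpow_le_rpow hq0 hqM hα.le) (by positivity) E.vhi_pos.le
  have h3 := abs_le.1 (hB θ hθ)
  have h4 : |E.slope (σ θ) * (v ^ E.κ - θ ^ E.κ * E.shockMoment) / E.κ| ≤
      E.slope (σ E.θhi) * (E.vhi ^ E.κ + E.θhi ^ E.κ * E.shockMoment) / E.κ := by
    rw [abs_div, abs_mul, abs_of_nonneg (E.slope_nonneg hs), abs_of_pos hκ]
    have a1 : v ^ E.κ ≤ E.vhi ^ E.κ := Real.rpow_le_rpow hv0 hv.2 hκ.le
    have a2 : θ ^ E.κ ≤ E.θhi ^ E.κ := Real.rpow_le_rpow hθ0 hθ.2 hκ.le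
    have a3 := mul_le_mul_of_nonneg_right a2 hA
    have a4 : 0 ≤ v ^ E.κ := Real.rpow_nonneg hv0 _
    have a5 : 0 ≤ θ ^ E.κ * E.shockMoment := mul_nonneg (Real.rpow_nonneg hθ0 _) hA
    refine div_le_div_of_nonneg_right ?_ hκ.le
    refine mul_le_mul (E.slope_mono hs hs') ?_ (abs_nonneg _) (E.slope_nonneg hS)
    exact abs_le.2 ⟨by linarith, by linarith⟩
  have h4 := abs_le.1 h4
  have h5 := mul_le_mul_of_nonneg_left hqM hc.le
  have h6 := mul_nonneg hc.le hq0
  simp only [E.mechQ_eq hθ, E.mechT_eq hθ]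
  exact abs_le.2 ⟨by linarith, by linarith⟩

/-- Mechanisms with increasing virtual fraction are incentive compatible, hence feasible if the
interim rent is at least the spot-market utility. -/
theorem isFeasible_mech {p : ℝ} (hσ0 : ∀ θ ∈ E.signals, 0 ≤ σ θ) (hσ : MonotoneOn σ E.signals)
    (hu : ∀ θ ∈ E.signals, E.spotUtility p θ ≤ E.envelopeRent σ u θ) :
    E.IsFeasible p (E.mechQ σ) (E.mechT σ u) where
  q_meas := measurable_mechQ hσ
  t_meas := measurable_mechT hσ0 hσ
  q_nonneg θ hθ v hv := by
    rw [E.mechQ_eq hθ]; exact E.alloc_nonneg (hσ0 θ hθ) (E.values_nonneg hv)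
  profit_integrable := integrable_profit_mech hσ0 hσ
  ic0 := ic0_mech hσ0 hσ
  ic1 := ic1_mech hσ0
  ir θ hθ := by
    change _ ≤ E.rent _ _ θ
    rw [rent_mech hθ]; exact hu θ hθ

end

section

variable (E : ServiceMarket)

/-! ### The spot market -/

theorem spotPayoff_eq {p v : ℝ} (hp : 0 < p) (hv : 0 ≤ v) :
    E.spotPayoff p v = E.slope (E.c / p) * v ^ E.κ / E.κ := by
  have hc := E.c_pos
  have hσ : 0 ≤ E.c / p := by positivity
  have hq0 := E.alloc_nonneg hσ hv
  -- the spot price `p` corresponds to the virtual fraction `c / p`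
  have key : ∀ q, E.payoff v q (p * q) = p / E.c * (E.c / p * v * q ^ E.α - E.c * q) := by
    intro q; simp only [payoff]; field_simp
  have hval : E.payoff v (E.alloc (E.c / p) v) (p * E.alloc (E.c / p) v)
      = E.slope (E.c / p) * v ^ E.κ / E.κ := by
    have h1 := E.alloc_optimal_aux (q := E.alloc (E.c / p) v) hσ hv
    rw [E.alloc_rpow_mul hσ hv, E.alloc_rpow hσ hv] at h1
    have h2 : E.c * (p * E.alloc (E.c / p) v)
        = E.c * (E.α * (v * (E.slope (E.c / p) * v ^ (E.κ - 1)))) := by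
      rw [mul_left_comm, ← h1]; field_simp
    have h3 := mul_left_cancel₀ hc.ne' h2
    have h4 : 1 / E.κ = 1 - E.α := by rw [κ, one_div_one_div]
    rw [payoff, h3, E.alloc_rpow hσ hv, mul_div_assoc, div_eq_mul_one_div (v ^ E.κ), h4,
      ← E.mul_rpow_κ_sub_one hv]
    ring
  rw [← hval]
  refine IsGreatest.csSup_eq ⟨⟨_, hq0, rfl⟩, ?_⟩
  rintro _ ⟨q, hq, rfl⟩
  simp only [key]
  exact mul_le_mul_of_nonneg_left (E.le_alloc hσ hv hq) (by positivity)

theorem spotUtility_eq {p θ : ℝ} (hp : 0 < p) (hθ : θ ∈ E.signals) :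
    E.spotUtility p θ = E.slope (E.c / p) * (θ ^ E.κ * E.shockMoment) / E.κ := by
  have h : E.spotUtility p θ = ∫ v, E.slope (E.c / p) * v ^ E.κ / E.κ ∂E.valueLaw θ := by
    refine integral_congr_ae ?_
    filter_upwards [E.ae_mem_values hθ] with v hv using E.spotPayoff_eq hp (E.values_nonneg hv)
  rw [h, E.integral_valueLaw θ (by fun_prop), integral_div, integral_const_mul,
    E.integral_shock_mul_rpow (E.signals_nonneg hθ)]

theorem spotUtility_nonneg {p θ : ℝ} (hp : 0 < p) (hθ : θ ∈ E.signals) :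
    0 ≤ E.spotUtility p θ := by
  rw [E.spotUtility_eq hp hθ]
  exact div_nonneg (mul_nonneg (E.slope_nonneg (div_nonneg E.c_pos.le hp.le))
    (mul_nonneg (Real.rpow_nonneg (E.signals_nonneg hθ) _) E.shockMoment_nonneg)) E.κ_pos.le

/-- The spot market leaves the interim rent of the allocation `alloc (c / p)`. -/
theorem spotUtility_sub {p x y : ℝ} (hp : 0 < p) (hx : x ∈ E.signals) (hy : y ∈ E.signals) :
    E.spotUtility p y = E.spotUtility p x + ∫ s in x..y, E.rentRate (fun _ => E.c / p) s := by
  rw [integral_rentRate_const, E.spotUtility_eq hp hx, E.spotUtility_eq hp hy]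
  ring

/-! ### The benchmark mechanism -/

/-- The virtual value as a fraction of the value, truncated at zero. -/
def virtualFraction (θ : ℝ) : ℝ := max (E.virtualF θ / θ) 0

theorem virtualFraction_nonneg (θ : ℝ) : 0 ≤ E.virtualFraction θ := le_max_right _ _

theorem qStar_eq {θ v : ℝ} (hv : 0 ≤ v) : E.qStar θ v = E.alloc (E.virtualFraction θ) v := by
  rw [qStar, alloc, virtualFraction, virtual, ← κ]
  congr 2
  rcases le_total 0 (E.virtualF θ / θ) with h | h
  · rw [if_pos (mul_nonneg hv h), max_eq_left h]
  · rw [max_eq_right h, mul_zero]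
    split_ifs with h'
    · exact le_antisymm (mul_nonpos_of_nonneg_of_nonpos hv h) h'
    · rfl

theorem measurable_qStar (θ : ℝ) : Measurable (E.qStar θ) := by
  have hv : Measurable (E.virtual θ) := measurable_id.mul_const _
  unfold qStar
  exact ((Measurable.ite (measurableSet_le measurable_const hv) hv measurable_const).const_mul
    _).pow_const _

theorem envelopeStar_eq {θ v : ℝ} (hv : v ∈ E.values) :
    E.envelopeStar θ v
      = E.slope (E.virtualFraction θ) * (v ^ E.κ - E.vlo ^ E.κ) / E.κ := by
  have h : E.envelopeStar θ v
      = ∫ x in E.vlo..v, E.slope (E.virtualFraction θ) * x ^ (E.κ - 1) := by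
    refine intervalIntegral.integral_congr fun x hx => ?_
    rw [uIcc_of_le hv.1] at hx
    have hx0 := E.vlo_nonneg.trans hx.1
    simp only [E.qStar_eq hx0]
    exact E.alloc_rpow (E.virtualFraction_nonneg θ) hx0
  rw [h, intervalIntegral.integral_const_mul, integral_rpow_sub_one E.one_lt_κ]
  ring

theorem integral_envelopeStar {θ : ℝ} (hθ : θ ∈ E.signals) :
    ∫ v, E.envelopeStar θ v ∂E.valueLaw θ
      = E.slope (E.virtualFraction θ) * (θ ^ E.κ * E.shockMoment - E.vlo ^ E.κ) / E.κ := by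
  have h : ∫ v, E.envelopeStar θ v ∂E.valueLaw θ
      = ∫ v, E.slope (E.virtualFraction θ) * (v ^ E.κ - E.vlo ^ E.κ) / E.κ ∂E.valueLaw θ := by
    refine integral_congr_ae ?_
    filter_upwards [E.ae_mem_values hθ] with v hv using E.envelopeStar_eq hv
  have hi : Integrable (fun z => (θ * z) ^ E.κ) E.shockLaw := by
    refine ((E.integrable_rpow_shock E.κ_pos.le).const_mul (θ ^ E.κ)).congr ?_
    filter_upwards [E.ae_mem_shocks] with z hz
    exact (Real.mul_rpow (E.signals_nonneg hθ) (E.zlo_nonneg.trans hz.1)).symm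
  rw [h, E.integral_valueLaw θ (by fun_prop), integral_div, integral_const_mul,
    integral_sub hi (integrable_const _), E.integral_shock_mul_rpow (E.signals_nonneg hθ)]
  simp

/-- The density of the shock, extended by zero. -/
def shockDensity : ℝ → ℝ := (Ioc E.zlo E.zhi).indicator E.h

theorem integrable_shockDensity : Integrable E.shockDensity :=
  (integrable_indicator_iff measurableSet_Ioc).2 E.h_intervalIntegrable.1

theorem shockLaw_real_Iic (y : ℝ) :
    E.shockLaw.real (Iic y) = ∫ z in Iic y, E.shockDensity z := by
  rw [← integral_indicator_one measurableSet_Iic, integral_shockLaw,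
    intervalIntegral.integral_of_le E.zlo_lt.le, ← integral_indicator measurableSet_Ioc,
    ← integral_indicator measurableSet_Iic]
  congr 1 with z
  simp only [shockDensity, indicator, Pi.one_apply]
  split_ifs <;> simp

theorem G_eq {θ : ℝ} (hθ : 0 < θ) (v : ℝ) : E.G θ v = E.shockLaw.real (Iic (v / θ)) := by
  rw [G, valueLaw, map_measureReal_apply (measurable_const_mul θ) measurableSet_Iic]
  congr 1 with z
  simp only [mem_preimage, mem_Iic]
  rw [le_div_iff₀' hθ]

/-- For almost every value, `∂G(v ∣ θ)/∂θ = -h(v / θ) v / θ ^ 2`. -/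
theorem ae_dG_eq {θ : ℝ} (hθ : 0 < θ) :
    ∀ᵐ v : ℝ, E.dG θ v = E.shockDensity (v / θ) * (-v / θ ^ 2) := by
  have h0 := LocallyIntegrable.ae_hasDerivAt_integral E.integrable_shockDensity.locallyIntegrable
  have hq : Measure.QuasiMeasurePreserving (fun v : ℝ => v / θ) volume volume := by
    refine ⟨by fun_prop, ?_⟩
    simp only [div_eq_mul_inv]
    rw [Real.map_volume_mul_right (inv_ne_zero hθ.ne')]
    exact Measure.smul_absolutelyContinuous
  filter_upwards [hq.ae h0] with v hv
  have hd1 : HasDerivAt (fun y => E.shockLaw.real (Iic y)) (E.shockDensity (v / θ)) (v / θ) := by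
    have h1 := (hv 0).const_add (∫ z in Iic (0 : ℝ), E.shockDensity z)
    refine h1.congr_of_eventuallyEq (Filter.Eventually.of_forall fun y => ?_)
    simp only [E.shockLaw_real_Iic y]
    rw [← intervalIntegral.integral_Iic_sub_Iic E.integrable_shockDensity.integrableOn
      E.integrable_shockDensity.integrableOn]
    ring
  have hd2 : HasDerivAt (fun x => v / x) (-v / θ ^ 2) θ := by
    simpa [div_eq_mul_inv] using (hasDerivAt_inv hθ.ne').const_mul v
  have hd3 := hd1.comp θ hd2
  refine (hd3.congr_of_eventuallyEq ?_).deriv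
  filter_upwards [lt_mem_nhds hθ] with x hx using E.G_eq hx v

theorem integral_qStar_mul_dG {θ : ℝ} (hθ : θ ∈ E.signals) (hθ0 : 0 < θ) :
    ∫ v in E.vlo..E.vhi, E.qStar θ v ^ E.α * E.dG θ v = -E.rentRate E.virtualFraction θ := by
  have h1 : ∫ v in E.vlo..E.vhi, E.qStar θ v ^ E.α * E.dG θ v
      = ∫ v in E.vlo..E.vhi, E.qStar θ v ^ E.α * (E.shockDensity (v / θ) * (-v / θ ^ 2)) := by
    refine intervalIntegral.integral_congr_ae ?_
    filter_upwards [E.ae_dG_eq hθ0] with v hv _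
    rw [hv]
  have h2 := intervalIntegral.integral_comp_mul_left (a := E.vlo / θ) (b := E.vhi / θ)
    (fun v => E.qStar θ v ^ E.α * (E.shockDensity (v / θ) * (-v / θ ^ 2))) hθ0.ne'
  rw [mul_div_cancel₀ _ hθ0.ne', mul_div_cancel₀ _ hθ0.ne', smul_eq_mul, eq_inv_mul_iff_mul_eq₀
    hθ0.ne'] at h2
  have hlo : E.vlo / θ ≤ E.zlo := by
    rw [div_le_iff₀' hθ0]; exact mul_le_mul_of_nonneg_right hθ.1 E.zlo_nonneg
  have hhi : E.zhi ≤ E.vhi / θ := by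
    rw [le_div_iff₀' hθ0]; exact mul_le_mul_of_nonneg_right hθ.2 E.zhi_pos.le
  rw [h1, ← h2, rentRate, ← E.integral_shock_mul_alloc (E.virtualFraction_nonneg θ) hθ0.le,
    integral_shockLaw, intervalIntegral.integral_of_le (hlo.trans (E.zlo_lt.le.trans hhi)),
    intervalIntegral.integral_of_le E.zlo_lt.le, ← integral_const_mul, ← integral_neg]
  have e : ∀ z, θ * (E.qStar θ (θ * z) ^ E.α * (E.shockDensity (θ * z / θ) * (-(θ * z) / θ ^ 2)))
      = (Ioc E.zlo E.zhi).indicator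
        (fun z => -(E.h z * (z * E.alloc (E.virtualFraction θ) (θ * z) ^ E.α))) z := by
    intro z
    rw [mul_div_cancel_left₀ _ hθ0.ne', shockDensity]
    by_cases hz : z ∈ Ioc E.zlo E.zhi
    · rw [indicator_of_mem hz, indicator_of_mem hz,
        E.qStar_eq (mul_nonneg hθ0.le (E.zlo_nonneg.trans hz.1.le))]
      field_simp
    · rw [indicator_of_notMem hz, indicator_of_notMem hz]; ring
  simp only [e]
  rw [setIntegral_indicator measurableSet_Ioc,
    inter_eq_right.2 (Ioc_subset_Ioc hlo hhi)]

/-- The interim rent of the benchmark is the envelope rent of its allocation. -/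
theorem interimRentStar_eq {θ : ℝ} (hθ : θ ∈ E.signals) :
    E.interimRentStar θ = E.envelopeRent E.virtualFraction 0 θ := by
  rw [interimRentStar, envelopeRent, zero_add, ← intervalIntegral.integral_neg]
  refine intervalIntegral.integral_congr_ae (Filter.Eventually.of_forall fun x hx => ?_)
  rw [uIoc_of_le hθ.1] at hx
  rw [E.integral_qStar_mul_dG ⟨hx.1.le, hx.2.trans hθ.2⟩ (E.θlo_nonneg.trans_lt hx.1), neg_neg]

theorem tStar_eq {θ v : ℝ} (hθ : θ ∈ E.signals) (hv : v ∈ E.values) :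
    E.tStar θ v = E.mechT E.virtualFraction 0 θ v := by
  rw [tStar, exPostRentStar, E.integral_envelopeStar hθ, E.envelopeStar_eq hv, E.mechT_eq hθ,
    E.qStar_eq (E.values_nonneg hv), E.interimRentStar_eq hθ]
  ring

theorem uStar_eq {θ : ℝ} (hθ : θ ∈ E.signals) :
    E.uStar θ = E.envelopeRent E.virtualFraction 0 θ := by
  rw [← rent_mech hθ, uStar, rent, interimUtility, interimUtility]
  refine integral_congr_ae ?_
  filter_upwards [E.ae_mem_values hθ] with v hv
  rw [E.tStar_eq hθ hv, E.qStar_eq (E.values_nonneg hv), E.mechQ_eq hθ]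

end

section

variable (E : ServiceMarket)

/-! ### Monotone hazard rate and the cutoff -/

theorem F_lo : E.F E.θlo = 0 := intervalIntegral.integral_same

theorem F_hi : E.F E.θhi = 1 := E.f_integral

theorem f_intervalIntegrable' {x y : ℝ} (hx : x ∈ E.signals) (hy : y ∈ E.signals) :
    IntervalIntegrable E.f volume x y :=
  E.f_intervalIntegrable.mono_set
    (by rw [uIcc_of_le E.θlo_lt.le]; exact ordConnected_Icc.uIcc_subset hx hy)

theorem F_strictMonoOn : StrictMonoOn E.F E.signals := by
  intro x hx y hy hxy
  have h := intervalIntegral.integral_add_adjacent_intervals (E.f_intervalIntegrable' E.θlo_mem hx)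
    (E.f_intervalIntegrable' hx hy)
  have hpos : 0 < ∫ s in x..y, E.f s :=
    intervalIntegral.intervalIntegral_pos_of_pos_on (E.f_intervalIntegrable' hx hy)
      (fun s hs => E.f_pos s ⟨hx.1.trans hs.1.le, hs.2.le.trans hy.2⟩) hxy
  simp only [F]
  linarith

theorem continuousOn_F : ContinuousOn E.F E.signals := by
  have := intervalIntegral.continuousOn_primitive_interval' E.f_intervalIntegrable left_mem_uIcc
  rwa [uIcc_of_le E.θlo_lt.le] at this

theorem F_le_one {θ : ℝ} (hθ : θ ∈ E.signals) : E.F θ ≤ 1 := by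
  rw [← E.F_hi]; exact E.F_strictMonoOn.monotoneOn hθ E.θhi_mem hθ.2

theorem F_lt_one {θ : ℝ} (hθ : θ ∈ E.signals) (h : θ < E.θhi) : E.F θ < 1 := by
  rw [← E.F_hi]; exact E.F_strictMonoOn hθ E.θhi_mem h

/-- The inverse hazard rate. -/
def invHazard (θ : ℝ) : ℝ := (1 - E.F θ) / E.f θ

theorem invHazard_nonneg {θ : ℝ} (hθ : θ ∈ E.signals) : 0 ≤ E.invHazard θ :=
  div_nonneg (by linarith [E.F_le_one hθ]) (E.f_pos θ hθ).le

theorem invHazard_pos {θ : ℝ} (hθ : θ ∈ E.signals) (h : θ < E.θhi) : 0 < E.invHazard θ :=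
  div_pos (by linarith [E.F_lt_one hθ h]) (E.f_pos θ hθ)

theorem virtualF_div {θ : ℝ} (hθ : 0 < θ) : E.virtualF θ / θ = 1 - E.invHazard θ / θ := by
  rw [virtualF, sub_div, div_self hθ.ne', invHazard]

theorem virtualF_div_hi : E.virtualF E.θhi / E.θhi = 1 := by
  rw [E.virtualF_div E.θhi_pos, invHazard, E.F_hi]; simp

variable {E} {p θs : ℝ}

theorem virtualF_div_lt (hE : E.MonotoneHazardRate) {x y : ℝ} (hx : x ∈ E.signals)
    (hy : y ∈ E.signals) (hx0 : 0 < x) (hxy : x < y) :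
    E.virtualF x / x < E.virtualF y / y := by
  rw [E.virtualF_div hx0, E.virtualF_div (hx0.trans hxy)]
  have h1 : E.invHazard y ≤ E.invHazard x := hE hx hy hxy.le
  have h2 := E.invHazard_pos hx (hxy.trans_le hy.2)
  have h3 : E.invHazard y / y ≤ E.invHazard x / y := by gcongr; linarith
  have h4 : E.invHazard x / y < E.invHazard x / x := by gcongr
  linarith

theorem virtualF_div_mono (hE : E.MonotoneHazardRate) {x y : ℝ} (hx : x ∈ E.signals)
    (hy : y ∈ E.signals) (hx0 : 0 < x) (hxy : x ≤ y) :
    E.virtualF x / x ≤ E.virtualF y / y := by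
  rcases hxy.eq_or_lt with rfl | h
  · exact le_rfl
  · exact (virtualF_div_lt hE hx hy hx0 h).le

theorem virtualFraction_monotoneOn (hE : E.MonotoneHazardRate) :
    MonotoneOn E.virtualFraction E.signals := by
  intro x hx y hy hxy
  rcases (E.signals_nonneg hx).eq_or_lt with rfl | hx0
  · simp [virtualFraction]
  · exact max_le_max_right _ (virtualF_div_mono hE hx hy hx0 hxy)

namespace IsCutoff

theorem ratio_ge (h : E.IsCutoff p θs) : E.c / p ≤ E.virtualF θs / θs := by
  rcases h.2 with h' | ⟨rfl, h'⟩
  · exact h'.ge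
  · exact h'.le

/-- A cutoff at zero would have ratio `0`, by the convention on division by zero. -/
theorem pos (h : E.IsCutoff p θs) (hp : E.c < p) : 0 < θs := by
  rcases (E.signals_nonneg h.1).eq_or_lt with rfl | h0
  · have := h.ratio_ge
    rw [div_zero] at this
    exact absurd this (not_le.2 (div_pos E.c_pos (E.c_pos.trans hp)))
  · exact h0

theorem le_ratio (hE : E.MonotoneHazardRate) (hp : E.c < p) (h : E.IsCutoff p θs) {θ : ℝ}
    (hθ : θ ∈ E.signals) (hle : θs ≤ θ) : E.c / p ≤ E.virtualF θ / θ :=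
  h.ratio_ge.trans (virtualF_div_mono hE h.1 hθ (h.pos hp) hle)

theorem ratio_lt (hE : E.MonotoneHazardRate) (h : E.IsCutoff p θs) {θ : ℝ}
    (hθ : θ ∈ E.signals) (hθ0 : 0 < θ) (hlt : θ < θs) : E.virtualF θ / θ < E.c / p := by
  rcases h.2 with h' | ⟨rfl, _⟩
  · rw [← h']; exact virtualF_div_lt hE hθ h.1 hθ0 hlt
  · exact absurd hθ.1 (not_le.2 hlt)

theorem unique (hE : E.MonotoneHazardRate) (hp : E.c < p) {x y : ℝ} (hx : E.IsCutoff p x)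
    (hy : E.IsCutoff p y) : x = y := by
  by_contra hne
  rcases lt_or_gt_of_ne hne with h | h
  · exact absurd hx.ratio_ge (not_le.2 (hy.ratio_lt hE hx.1 (hx.pos hp) h))
  · exact absurd hy.ratio_ge (not_le.2 (hx.ratio_lt hE hy.1 (hy.pos hp) h))

end IsCutoff

theorem exists_isCutoff (hE : E.MonotoneHazardRate) (hp : E.c < p)
    (hf : ContinuousOn E.f E.signals) : ∃ θs, E.IsCutoff p θs := by
  have hp0 := E.c_pos.trans hp
  have hcp : 0 < E.c / p := div_pos E.c_pos hp0
  have hcp1 : E.c / p < 1 := (div_lt_one hp0).2 hp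
  by_cases hlo : E.c / p < E.virtualF E.θlo / E.θlo
  · exact ⟨E.θlo, E.θlo_mem, Or.inr ⟨rfl, hlo⟩⟩
  obtain ⟨a, ha, ha0, hac⟩ : ∃ a ∈ E.signals, 0 < a ∧ E.virtualF a / a ≤ E.c / p := by
    rcases E.θlo_nonneg.eq_or_lt with h0 | h0
    · -- near the signal `0` the virtual value is negative
      have hhi := E.θhi_pos
      have hm : E.θhi / 2 ∈ E.signals := ⟨by rw [← h0]; positivity, by linarith⟩
      have hm0 := E.invHazard_pos hm (by linarith)
      have ha0 : 0 < min (E.θhi / 2) (E.invHazard (E.θhi / 2)) := lt_min (by positivity) hm0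
      have ha : min (E.θhi / 2) (E.invHazard (E.θhi / 2)) ∈ E.signals :=
        ⟨by rw [← h0]; exact ha0.le, (min_le_left _ _).trans hm.2⟩
      refine ⟨_, ha, ha0, ?_⟩
      rw [E.virtualF_div ha0]
      have h1 : E.invHazard (E.θhi / 2) ≤ E.invHazard _ := hE ha hm (min_le_left _ _)
      have h2 := (one_le_div ha0).2 ((min_le_right _ _).trans h1)
      linarith
    · exact ⟨E.θlo, E.θlo_mem, h0, not_lt.1 hlo⟩
  have hsub : Icc a E.θhi ⊆ E.signals := Icc_subset_Icc_left ha.1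
  have hcont : ContinuousOn (fun θ => E.virtualF θ / θ) (Icc a E.θhi) := by
    refine ContinuousOn.div (continuousOn_id.sub ?_) continuousOn_id
      fun x hx => (ha0.trans_le hx.1).ne'
    exact (continuousOn_const.sub (E.continuousOn_F.mono hsub)).div (hf.mono hsub)
      fun x hx => (E.f_pos x (hsub hx)).ne'
  obtain ⟨s, hs, hs'⟩ := intermediate_value_Icc ha.2 hcont
    ⟨hac, by rw [E.virtualF_div_hi]; exact hcp1.le⟩
  exact ⟨s, hsub hs, Or.inl hs'⟩

end

section

variable (E : ServiceMarket)

/-! ### The constrained-optimal mechanism -/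

/-- The virtual fraction of the constrained-optimal mechanism: the spot-market fraction `c / p`
below the cutoff and that of the benchmark from the cutoff on. -/
def cutoffFraction (p θs θ : ℝ) : ℝ := if θ < θs then E.c / p else E.virtualF θ / θ

variable {E} {p θs : ℝ}

theorem cutoffFraction_of_lt {θ : ℝ} (h : θ < θs) : E.cutoffFraction p θs θ = E.c / p := if_pos h

theorem cutoffFraction_of_ge {θ : ℝ} (h : θs ≤ θ) :
    E.cutoffFraction p θs θ = E.virtualF θ / θ := if_neg (not_lt.2 h)

theorem div_price_pos (hp : E.c < p) : 0 < E.c / p := div_pos E.c_pos (E.c_pos.trans hp)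

theorem cutoffFraction_eq_virtualFraction (hE : E.MonotoneHazardRate) (hp : E.c < p)
    (h : E.IsCutoff p θs) {θ : ℝ} (hθ : θ ∈ E.signals) (hle : θs ≤ θ) :
    E.cutoffFraction p θs θ = E.virtualFraction θ := by
  have := h.le_ratio hE hp hθ hle
  rw [cutoffFraction_of_ge hle, virtualFraction, max_eq_left]
  exact (div_price_pos hp).le.trans this

theorem le_cutoffFraction (hE : E.MonotoneHazardRate) (hp : E.c < p) (h : E.IsCutoff p θs)
    {θ : ℝ} (hθ : θ ∈ E.signals) : E.c / p ≤ E.cutoffFraction p θs θ := by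
  rcases lt_or_ge θ θs with hlt | hge
  · rw [cutoffFraction_of_lt hlt]
  · rw [cutoffFraction_of_ge hge]; exact h.le_ratio hE hp hθ hge

theorem cutoffFraction_nonneg (hE : E.MonotoneHazardRate) (hp : E.c < p) (h : E.IsCutoff p θs) :
    ∀ θ ∈ E.signals, 0 ≤ E.cutoffFraction p θs θ := fun _ hθ =>
  (div_price_pos hp).le.trans (le_cutoffFraction hE hp h hθ)

theorem cutoffFraction_monotoneOn (hE : E.MonotoneHazardRate) (hp : E.c < p)
    (h : E.IsCutoff p θs) : MonotoneOn (E.cutoffFraction p θs) E.signals := by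
  intro x hx y hy hxy
  rcases lt_or_ge x θs with hlt | hge
  · rw [cutoffFraction_of_lt hlt]; exact le_cutoffFraction hE hp h hy
  · rw [cutoffFraction_of_ge hge, cutoffFraction_of_ge (hge.trans hxy)]
    exact virtualF_div_mono hE hx hy ((h.pos hp).trans_le hge) hxy

theorem virtualFraction_lt (hE : E.MonotoneHazardRate) (hp : E.c < p) (h : E.IsCutoff p θs)
    {θ : ℝ} (hθ : θ ∈ E.signals) (hlt : θ < θs) : E.virtualFraction θ < E.c / p := by
  refine max_lt ?_ (div_price_pos hp)
  rcases (E.signals_nonneg hθ).eq_or_lt with rfl | h0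
  · rw [div_zero]; exact div_price_pos hp
  · exact h.ratio_lt hE hθ h0 hlt

theorem monotoneOn_rentRate_virtualFraction (hE : E.MonotoneHazardRate) :
    MonotoneOn (E.rentRate E.virtualFraction) E.signals :=
  E.monotoneOn_rentRate (fun _ _ => E.virtualFraction_nonneg _) (virtualFraction_monotoneOn hE)

theorem monotoneOn_rentRate_const (hp : E.c < p) :
    MonotoneOn (E.rentRate fun _ => E.c / p) E.signals :=
  E.monotoneOn_rentRate (fun _ _ => (div_price_pos hp).le) monotoneOn_const

theorem monotoneOn_rentRate_cutoffFraction (hE : E.MonotoneHazardRate) (hp : E.c < p)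
    (h : E.IsCutoff p θs) : MonotoneOn (E.rentRate (E.cutoffFraction p θs)) E.signals :=
  E.monotoneOn_rentRate (cutoffFraction_nonneg hE hp h) (cutoffFraction_monotoneOn hE hp h)

/-- Below the cutoff the benchmark distorts quantities below spot-market demand, so the spot
market leaves more rent than the benchmark. -/
theorem discount_nonneg (hE : E.MonotoneHazardRate) (hp : E.c < p) (h : E.IsCutoff p θs) :
    0 ≤ E.discount p θs := by
  have hp0 := E.c_pos.trans hp
  rw [discount, E.uStar_eq h.1, E.spotUtility_sub hp0 E.θlo_mem h.1, envelopeRent]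
  have h0 := E.spotUtility_nonneg hp0 E.θlo_mem
  have h1 : ∫ x in E.θlo..θs, E.rentRate E.virtualFraction x
      ≤ ∫ x in E.θlo..θs, E.rentRate (fun _ => E.c / p) x := by
    refine intervalIntegral.integral_mono_on_of_le_Ioo h.1.1
      (E.intervalIntegrable_of_monotoneOn (monotoneOn_rentRate_virtualFraction hE) E.θlo_mem h.1)
      (E.intervalIntegrable_of_monotoneOn (monotoneOn_rentRate_const hp) E.θlo_mem h.1)
      fun x hx => ?_
    have hxm : x ∈ E.signals := ⟨hx.1.le, hx.2.le.trans h.1.2⟩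
    exact E.rentRate_mono (E.signals_nonneg hxm) (E.virtualFraction_nonneg x)
      (virtualFraction_lt hE hp h hxm hx.2).le
  linarith

variable (E p θs) in
/-- The interim rent of the constrained-optimal mechanism. -/
def optimalRent (θ : ℝ) : ℝ := E.envelopeRent (E.cutoffFraction p θs) (E.spotUtility p E.θlo) θ

/-- Up to the cutoff the participation constraint binds. -/
theorem optimalRent_of_le (hp : E.c < p) {θ : ℝ} (hθ : θ ∈ E.signals) (hle : θ ≤ θs) : E.optimalRent p θs θ = E.spotUtility p θ := by
  rw [optimalRent, envelopeRent, E.spotUtility_sub (E.c_pos.trans hp) E.θlo_mem hθ]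
  congr 1
  have hne : ∀ᵐ x : ℝ, x ≠ θs := by simp [ae_iff, measure_singleton]
  refine intervalIntegral.integral_congr_ae ?_
  filter_upwards [hne] with x hx hxm
  rw [uIoc_of_le hθ.1] at hxm
  rw [rentRate, rentRate, cutoffFraction_of_lt (lt_of_le_of_ne (hxm.2.trans hle) hx)]

theorem optimalRent_sub (hE : E.MonotoneHazardRate) (hp : E.c < p) (h : E.IsCutoff p θs)
    {θ : ℝ} (hθ : θ ∈ E.signals) : E.optimalRent p θs θ
      = E.spotUtility p θs + ∫ x in θs..θ, E.rentRate (E.cutoffFraction p θs) x := by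
  rw [← optimalRent_of_le hp h.1 le_rfl]
  exact envelopeRent_sub (cutoffFraction_nonneg hE hp h) (cutoffFraction_monotoneOn hE hp h) h.1 hθ

/-- From the cutoff on the interim rent is that of the benchmark plus the discount. -/
theorem optimalRent_of_ge (hE : E.MonotoneHazardRate) (hp : E.c < p) (h : E.IsCutoff p θs)
    {θ : ℝ} (hθ : θ ∈ E.signals) (hle : θs ≤ θ) : E.optimalRent p θs θ
      = E.envelopeRent E.virtualFraction 0 θ + E.discount p θs := by
  rw [optimalRent_sub hE hp h hθ, discount, E.uStar_eq h.1,
    envelopeRent_sub (fun _ _ => E.virtualFraction_nonneg _) (virtualFraction_monotoneOn hE) h.1 hθ]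
  have : ∫ x in θs..θ, E.rentRate (E.cutoffFraction p θs) x
      = ∫ x in θs..θ, E.rentRate E.virtualFraction x := by
    refine intervalIntegral.integral_congr fun x hx => ?_
    rw [uIcc_of_le hle] at hx
    rw [rentRate, rentRate, cutoffFraction_eq_virtualFraction hE hp h
      ⟨h.1.1.trans hx.1, hx.2.trans hθ.2⟩ hx.1]
  rw [this]; ring

theorem spotUtility_le_optimalRent (hE : E.MonotoneHazardRate) (hp : E.c < p)
    (h : E.IsCutoff p θs) {θ : ℝ} (hθ : θ ∈ E.signals) :
    E.spotUtility p θ ≤ E.optimalRent p θs θ := by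
  rw [optimalRent, envelopeRent, E.spotUtility_sub (E.c_pos.trans hp) E.θlo_mem hθ]
  gcongr
  refine intervalIntegral.integral_mono_on hθ.1
    (E.intervalIntegrable_of_monotoneOn (monotoneOn_rentRate_const hp) E.θlo_mem hθ)
    (E.intervalIntegrable_of_monotoneOn (monotoneOn_rentRate_cutoffFraction hE hp h) E.θlo_mem hθ)
    fun x hx => ?_
  have hxm : x ∈ E.signals := ⟨hx.1, hx.2.trans hθ.2⟩
  exact E.rentRate_mono (E.signals_nonneg hxm) (div_price_pos hp).le (le_cutoffFraction hE hp h hxm)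

variable (E p θs) in
/-- The constrained-optimal allocation. -/
def optimalQ : ℝ → ℝ → ℝ := E.mechQ (E.cutoffFraction p θs)

variable (E p θs) in
/-- The constrained-optimal transfers. -/
def optimalT : ℝ → ℝ → ℝ := E.mechT (E.cutoffFraction p θs) (E.spotUtility p E.θlo)

theorem isFeasible_optimal (hE : E.MonotoneHazardRate) (hp : E.c < p) (h : E.IsCutoff p θs) :
    E.IsFeasible p (E.optimalQ p θs) (E.optimalT p θs) :=
  isFeasible_mech (cutoffFraction_nonneg hE hp h) (cutoffFraction_monotoneOn hE hp h)
    fun _ hθ => spotUtility_le_optimalRent hE hp h hθ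

theorem rent_optimal {θ : ℝ} (hθ : θ ∈ E.signals) :
    E.rent (E.optimalQ p θs) (E.optimalT p θs) θ = E.optimalRent p θs θ := rent_mech hθ

theorem optimalQ_eq {θ : ℝ} (hθ : θ ∈ E.signals) (v : ℝ) :
    E.optimalQ p θs θ v = E.alloc (E.cutoffFraction p θs θ) v := E.mechQ_eq hθ v

theorem optimalQ_eq_qStar_iff (hE : E.MonotoneHazardRate) (hp : E.c < p) (h : E.IsCutoff p θs)
    {θ v : ℝ} (hθ : θ ∈ E.signals) (hv : 0 < v) :
    E.optimalQ p θs θ v = E.qStar θ v ↔ θs ≤ θ := by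
  rw [optimalQ_eq hθ, E.qStar_eq hv.le]
  constructor
  · intro he
    by_contra hlt
    rw [not_le] at hlt
    have := E.alloc_injOn (cutoffFraction_nonneg hE hp h θ hθ) (E.virtualFraction_nonneg θ) hv he
    rw [cutoffFraction_of_lt hlt] at this
    exact (virtualFraction_lt hE hp h hθ hlt).ne' this
  · intro hle
    rw [cutoffFraction_eq_virtualFraction hE hp h hθ hle]

theorem optimalQ_eq_qStar (hE : E.MonotoneHazardRate) (hp : E.c < p) (h : E.IsCutoff p θs)
    {θ v : ℝ} (hθ : θ ∈ E.signals) (hv : 0 ≤ v) (hle : θs ≤ θ) :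
    E.optimalQ p θs θ v = E.qStar θ v := by
  rw [optimalQ_eq hθ, E.qStar_eq hv, cutoffFraction_eq_virtualFraction hE hp h hθ hle]

theorem optimalT_eq (hE : E.MonotoneHazardRate) (hp : E.c < p) (h : E.IsCutoff p θs)
    {θ v : ℝ} (hθ : θ ∈ E.signals) (hv : v ∈ E.values) (hle : θs ≤ θ) :
    E.optimalT p θs θ v = E.tStar θ v - E.discount p θs := by
  have := optimalRent_of_ge hE hp h hθ hle
  rw [optimalRent] at this
  rw [E.tStar_eq hθ hv, optimalT, E.mechT_eq hθ, E.mechT_eq hθ, this,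
    cutoffFraction_eq_virtualFraction hE hp h hθ hle]
  ring

/-! ### Optimality -/

variable (E p θs) in
/-- The cumulated multiplier of the participation constraints at signals above `θ`. -/
def multiplier (θ : ℝ) : ℝ :=
  if θ < θs then 1 - E.F θ - (1 - E.c / p) * θ * E.f θ else 0

theorem multiplier_eq {θ : ℝ} (hθ : θ ∈ E.signals) (hlt : θ < E.θhi) (hlts : θ < θs) :
    E.multiplier p θs θ = (1 - E.F θ) * (1 - (1 - E.c / p) * θ / E.invHazard θ) := by
  have h1 := E.F_lt_one hθ hlt
  have h2 := E.f_pos θ hθ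
  have h3 : 1 - E.F θ ≠ 0 := by linarith
  rw [multiplier, if_pos hlts, invHazard]
  field_simp

theorem mul_le_invHazard (hE : E.MonotoneHazardRate) (h : E.IsCutoff p θs)
    {θ : ℝ} (hθ : θ ∈ E.signals) (hlt : θ < θs) : (1 - E.c / p) * θ ≤ E.invHazard θ := by
  rcases (E.signals_nonneg hθ).eq_or_lt with rfl | h0
  · rw [mul_zero]; exact E.invHazard_nonneg hθ
  · have h1 := h.ratio_lt hE hθ h0 hlt
    rw [E.virtualF_div h0] at h1
    have h2 : 1 - E.c / p ≤ E.invHazard θ / θ := by linarith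
    exact (le_div_iff₀ h0).1 h2

theorem multiplier_nonneg (hE : E.MonotoneHazardRate) (h : E.IsCutoff p θs) {θ : ℝ}
    (hθ : θ ∈ E.signals) : 0 ≤ E.multiplier p θs θ := by
  rcases lt_or_ge θ θs with hlt | hge
  · have hlt' := hlt.trans_le h.1.2
    rw [multiplier_eq hθ hlt' hlt]
    refine mul_nonneg (by linarith [E.F_le_one hθ]) (sub_nonneg.2 ?_)
    exact (div_le_one (E.invHazard_pos hθ hlt')).2 (mul_le_invHazard hE h hθ hlt)
  · rw [multiplier, if_neg (not_lt.2 hge)]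

/-- The multiplier of the participation constraints is a positive measure: this is where the
monotone hazard rate enters. -/
theorem multiplier_antitoneOn (hE : E.MonotoneHazardRate) (hp : E.c < p) (h : E.IsCutoff p θs) :
    AntitoneOn (E.multiplier p θs) E.signals := by
  intro x hx y hy hxy
  rcases lt_or_ge y θs with hlt | hge
  · have hyh := hlt.trans_le h.1.2
    have hβ : 0 ≤ 1 - E.c / p := sub_nonneg.2 ((div_lt_one (E.c_pos.trans hp)).2 hp).le
    rw [multiplier_eq hx (hxy.trans_lt hyh) (hxy.trans_lt hlt), multiplier_eq hy hyh hlt]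
    have h1 : E.F x ≤ E.F y := E.F_strictMonoOn.monotoneOn hx hy hxy
    have h2 := E.F_le_one hx
    have h3 := E.invHazard_pos hy hyh
    have h4 : E.invHazard y ≤ E.invHazard x := hE hx hy hxy
    have h5 : (1 - E.c / p) * x / E.invHazard x ≤ (1 - E.c / p) * y / E.invHazard y :=
      div_le_div₀ (mul_nonneg hβ (E.signals_nonneg hy)) (mul_le_mul_of_nonneg_left hxy hβ) h3 h4
    have h6 := (div_le_one h3).2 (mul_le_invHazard hE h hy hlt)
    exact mul_le_mul (by linarith) (by linarith) (by linarith) (by linarith)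
  · have := multiplier_nonneg hE h hx
    rwa [multiplier, if_neg (not_lt.2 hge)]

theorem multiplier_lo_le_one (hp : E.c < p) : E.multiplier p θs E.θlo ≤ 1 := by
  have hβ : 0 ≤ 1 - E.c / p := sub_nonneg.2 ((div_lt_one (E.c_pos.trans hp)).2 hp).le
  rw [multiplier]
  split_ifs
  · rw [E.F_lo]
    have := mul_nonneg (mul_nonneg hβ E.θlo_nonneg) (E.f_pos _ E.θlo_mem).le
    linarith
  · exact zero_le_one

/-- The distortion weight `f(θ) (θ - θ σ(θ))` is `1 - F(θ)`, as in the benchmark, less the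
multiplier. -/
theorem f_mul_sub (hp : E.c < p) (h : E.IsCutoff p θs) {θ : ℝ} (hθ : θ ∈ E.signals) :
    E.f θ * (θ - E.cutoffFraction p θs θ * θ) = 1 - E.F θ - E.multiplier p θs θ := by
  rcases lt_or_ge θ θs with hlt | hge
  · rw [cutoffFraction_of_lt hlt, multiplier, if_pos hlt]; ring
  · have h0 := ((h.pos hp).trans_le hge).ne'
    have h1 := (E.f_pos θ hθ).ne'
    rw [cutoffFraction_of_ge hge, multiplier, if_neg (not_lt.2 hge), div_mul_cancel₀ _ h0, virtualF]
    field_simp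
    ring

theorem integrable_signalLaw {φ : ℝ → ℝ} (hφ : MonotoneOn φ E.signals) :
    Integrable φ E.signalLaw := by
  have hm : AEMeasurable φ E.signalLaw :=
    (aemeasurable_restrict_of_monotoneOn measurableSet_Icc hφ).mono_ac
      E.signalLaw_absolutelyContinuous
  refine Integrable.of_bound hm.aestronglyMeasurable (max |φ E.θlo| |φ E.θhi|) ?_
  filter_upwards [E.ae_mem_signals] with θ hθ
  exact abs_le_max_abs_abs (hφ E.θlo_mem hθ hθ.1) (hφ hθ E.θhi_mem hθ.2)

namespace IsFeasible

variable {q t : ℝ → ℝ → ℝ}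

theorem marginalRent_nonneg (hf : E.IsFeasible p q t) {θ : ℝ} (hθ : θ ∈ E.signals) :
    0 ≤ E.marginalRent q θ := by
  refine integral_nonneg_of_ae ?_
  filter_upwards [E.ae_mem_shocks] with z hz
  exact mul_nonneg (E.zlo_nonneg.trans hz.1)
    (Real.rpow_nonneg (hf.q_nonneg θ hθ _ (E.mul_mem_values hθ hz)) _)

theorem rent_monotoneOn (hf : E.IsFeasible p q t) : MonotoneOn (E.rent q t) E.signals := by
  intro x hx y hy hxy
  have h1 := hf.rent_subgradient x hx y hy
  have h2 := mul_nonneg (sub_nonneg.2 hxy) (hf.marginalRent_nonneg hx)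
  linarith

theorem integrable_mul_marginalRent (hf : E.IsFeasible p q t) {φ : ℝ → ℝ}
    (hφ0 : ∀ θ ∈ E.signals, 0 ≤ φ θ) (hφ : MonotoneOn φ E.signals) :
    Integrable (fun θ => φ θ * E.marginalRent q θ) E.signalLaw :=
  integrable_signalLaw fun _ hx y hy hxy => mul_le_mul (hφ hx hy hxy)
    (hf.marginalRent_monotoneOn hx hy hxy) (hf.marginalRent_nonneg hx) (hφ0 y hy)

variable (E p θs q t) in
/-- The loss from distortions and excess rents of a mechanism relative to the optimal one. -/
def rentLoss (θ : ℝ) : ℝ := E.rent q t θ - E.optimalRent p θs θ -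
  (θ - E.cutoffFraction p θs θ * θ) *
    (E.marginalRent q θ - E.marginalRent (E.optimalQ p θs) θ)

theorem integrable_rentLoss (hf : E.IsFeasible p q t) (hE : E.MonotoneHazardRate)
    (hp : E.c < p) (h : E.IsCutoff p θs) : Integrable (rentLoss E p θs q t) E.signalLaw := by
  have hf' := isFeasible_optimal hE hp h
  have hσ0 := cutoffFraction_nonneg hE hp h
  have hσ := cutoffFraction_monotoneOn hE hp h
  have m1 : ∀ θ ∈ E.signals, 0 ≤ θ := fun θ hθ => E.signals_nonneg hθ
  have m2 : ∀ θ ∈ E.signals, 0 ≤ E.cutoffFraction p θs θ * θ := fun θ hθ =>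
    mul_nonneg (hσ0 θ hθ) (m1 θ hθ)
  have m3 : MonotoneOn (fun θ => E.cutoffFraction p θs θ * θ) E.signals :=
    fun x hx y hy hxy => mul_le_mul (hσ hx hy hxy) hxy (m1 x hx) (hσ0 y hy)
  have i1 := integrable_signalLaw hf.rent_monotoneOn
  have i2 := integrable_signalLaw hf'.rent_monotoneOn
  have i3 := hf.integrable_mul_marginalRent m1 monotoneOn_id
  have i4 := hf'.integrable_mul_marginalRent m1 monotoneOn_id
  have i5 := hf.integrable_mul_marginalRent m2 m3
  have i6 := hf'.integrable_mul_marginalRent m2 m3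
  refine (((i1.sub i2).sub ((i3.sub i4).sub (i5.sub i6)))).congr ?_
  filter_upwards [E.ae_mem_signals] with θ hθ
  simp only [rentLoss, Pi.sub_apply, rent_optimal hθ]
  ring

theorem rent_sub_optimalRent (hf : E.IsFeasible p q t) (hE : E.MonotoneHazardRate)
    (hp : E.c < p) (h : E.IsCutoff p θs) {θ : ℝ} (hθ : θ ∈ E.signals) :
    E.rent q t θ - E.optimalRent p θs θ = E.rent q t E.θlo - E.spotUtility p E.θlo +
      ∫ x in E.θlo..θ, (E.marginalRent q x - E.marginalRent (E.optimalQ p θs) x) := by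
  have hf' := isFeasible_optimal hE hp h
  have h2 := hf'.rent_eq hθ
  rw [rent_optimal hθ, rent_optimal E.θlo_mem, optimalRent_of_le hp E.θlo_mem h.1.1] at h2
  rw [intervalIntegral.integral_sub
    (E.intervalIntegrable_of_monotoneOn hf.marginalRent_monotoneOn E.θlo_mem hθ)
    (E.intervalIntegrable_of_monotoneOn hf'.marginalRent_monotoneOn E.θlo_mem hθ),
    hf.rent_eq hθ, h2]
  ring

/-- Integrated by parts, the rent loss is the excess rent at the lowest signal plus the multiplier
integrated against the marginal excess rent. It is nonnegative by Bonnet's inequality, because the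
excess rent is nonnegative wherever the participation constraint has a multiplier. -/
theorem integral_rentLoss_nonneg (hf : E.IsFeasible p q t) (hE : E.MonotoneHazardRate)
    (hp : E.c < p) (h : E.IsCutoff p θs) : 0 ≤ ∫ θ, rentLoss E p θs q t θ ∂E.signalLaw := by
  have hf' := isFeasible_optimal hE hp h
  set δ := fun x => E.marginalRent q x - E.marginalRent (E.optimalQ p θs) x with hδ
  set d := E.rent q t E.θlo - E.spotUtility p E.θlo with hd
  set g := E.multiplier p θs with hg
  have hIcc : uIcc E.θlo E.θhi = E.signals := uIcc_of_le E.θlo_lt.le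
  have hδi : IntervalIntegrable δ volume E.θlo E.θhi :=
    (E.intervalIntegrable_of_monotoneOn hf.marginalRent_monotoneOn E.θlo_mem E.θhi_mem).sub
    (E.intervalIntegrable_of_monotoneOn hf'.marginalRent_monotoneOn E.θlo_mem E.θhi_mem)
  have hganti := multiplier_antitoneOn hE hp h
  have hg0 : ∀ x ∈ E.signals, 0 ≤ g x := fun x hx => multiplier_nonneg hE h hx
  have hgδ : IntervalIntegrable (fun x => g x * δ x) volume E.θlo E.θhi := by
    rw [intervalIntegrable_iff, uIoc_of_le E.θlo_lt.le]
    have hδ' : Integrable δ (volume.restrict (Ioc E.θlo E.θhi)) := hδi.1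
    refine hδ'.bdd_mul (c := g E.θlo) (aemeasurable_restrict_of_antitoneOn measurableSet_Ioc
      (hganti.mono Ioc_subset_Icc_self)).aestronglyMeasurable ?_
    filter_upwards [ae_restrict_mem measurableSet_Ioc] with x hx
    have hx' := Ioc_subset_Icc_self hx
    rw [Real.norm_eq_abs, abs_of_nonneg (hg0 x hx')]
    exact hganti E.θlo_mem hx' hx'.1
  have hNδ : IntervalIntegrable (fun x => (1 - ∫ t in E.θlo..x, E.f t) * δ x) volume
      E.θlo E.θhi :=
    hδi.continuousOn_mul (by rw [hIcc]; exact continuousOn_const.sub E.continuousOn_F)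
  have hfD : IntervalIntegrable (fun x => E.f x * (d + ∫ t in E.θlo..x, δ t)) volume
      E.θlo E.θhi := by
    refine E.f_intervalIntegrable.mul_continuousOn (continuousOn_const.add ?_)
    exact intervalIntegral.continuousOn_primitive_interval' hδi left_mem_uIcc
  have e1 : ∫ θ, rentLoss E p θs q t θ ∂E.signalLaw = d + ∫ x in E.θlo..E.θhi, g x * δ x := by
    have hparts := integral_mul_primitive (d := d) E.f_intervalIntegrable hδi E.f_integral
    have e2 : ∫ θ, rentLoss E p θs q t θ ∂E.signalLaw = ∫ x in E.θlo..E.θhi,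
        (E.f x * (d + ∫ t in E.θlo..x, δ t) - (1 - ∫ t in E.θlo..x, E.f t) * δ x + g x * δ x) := by
      rw [integral_signalLaw]
      refine intervalIntegral.integral_congr fun x hx => ?_
      rw [hIcc] at hx
      have h1 := f_mul_sub hp h hx
      simp only [rentLoss]
      rw [hf.rent_sub_optimalRent hE hp h hx, mul_sub, ← mul_assoc, h1]
      simp only [F, hδ, hg, hd]
      ring
    rw [e2, intervalIntegral.integral_add (hfD.sub hNδ) hgδ, intervalIntegral.integral_sub hfD hNδ,
      hparts]
    ring
  have hbonnet := neg_mul_le_integral_antitone_mul (d := d) E.θlo_lt.le hganti hg0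
    (c := θs) (fun x _ hx => by rw [multiplier, if_neg (not_lt.2 hx)]) h.1.1 hδi (by
      intro x hx hxs
      have h1 := hf.rent_sub_optimalRent hE hp h hx
      rw [optimalRent_of_le hp hx hxs] at h1
      have h2 := hf.ir x hx
      change _ ≤ E.rent q t x at h2
      linarith)
  have hd0 : 0 ≤ d := sub_nonneg.2 (hf.ir _ E.θlo_mem)
  have hglo : g E.θlo ≤ 1 := multiplier_lo_le_one hp
  have := mul_nonneg hd0 (sub_nonneg.2 hglo)
  rw [e1]
  linarith

variable (E p θs q) in
/-- The loss in virtual surplus of an allocation relative to the optimal one. -/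
def surplusLoss (θ : ℝ) : ℝ :=
  (E.cutoffFraction p θs θ * θ * E.marginalRent (E.optimalQ p θs) θ
      - E.c * E.expectedQuantity (E.optimalQ p θs) θ)
    - (E.cutoffFraction p θs θ * θ * E.marginalRent q θ - E.c * E.expectedQuantity q θ)

theorem surplusLoss_nonneg (hf : E.IsFeasible p q t) (hE : E.MonotoneHazardRate)
    (hp : E.c < p) (h : E.IsCutoff p θs) {θ : ℝ} (hθ : θ ∈ E.signals) :
    0 ≤ surplusLoss E p θs q θ :=
  sub_nonneg.2 (hf.virtualSurplus_le (isFeasible_optimal hE hp h) hθ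
    (cutoffFraction_nonneg hE hp h θ hθ) fun v _ => optimalQ_eq hθ v)

/-- The profit lost relative to the optimal mechanism. -/
theorem profit_sub_profit (hf : E.IsFeasible p q t) (hE : E.MonotoneHazardRate)
    (hp : E.c < p) (h : E.IsCutoff p θs) : Integrable (surplusLoss E p θs q) E.signalLaw ∧
      E.profit (E.optimalQ p θs) (E.optimalT p θs) - E.profit q t
        = (∫ θ, surplusLoss E p θs q θ ∂E.signalLaw) +
          ∫ θ, rentLoss E p θs q t θ ∂E.signalLaw := by
  have hf' := isFeasible_optimal hE hp h
  have hS := hf.integrable_rentLoss hE hp h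
  have hi : Integrable (surplusLoss E p θs q) E.signalLaw := by
    refine ((hf'.integrable_profit.sub hf.integrable_profit).sub hS).congr ?_
    filter_upwards [E.ae_mem_signals] with θ hθ
    simp only [rentLoss, surplusLoss, Pi.sub_apply, rent_optimal hθ]
    ring
  refine ⟨hi, ?_⟩
  rw [hf'.profit_eq, hf.profit_eq, ← integral_sub hf'.integrable_profit hf.integrable_profit,
    ← integral_add hi hS]
  refine integral_congr_ae ?_
  filter_upwards [E.ae_mem_signals] with θ hθ
  simp only [rentLoss, surplusLoss, rent_optimal hθ]
  ring

end IsFeasible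

theorem isOptimal_optimal (hE : E.MonotoneHazardRate) (hp : E.c < p) (h : E.IsCutoff p θs) :
    E.IsOptimal p (E.optimalQ p θs) (E.optimalT p θs) := by
  refine ⟨isFeasible_optimal hE hp h, fun q t hf => ?_⟩
  obtain ⟨_, h1⟩ := hf.profit_sub_profit hE hp h
  have h2 := hf.integral_rentLoss_nonneg hE hp h
  have h3 : 0 ≤ ∫ θ, IsFeasible.surplusLoss E p θs q θ ∂E.signalLaw :=
    integral_nonneg_of_ae (by
      filter_upwards [E.ae_mem_signals] with θ hθ using hf.surplusLoss_nonneg hE hp h hθ)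
  linarith

/-! ### Uniqueness -/

variable {q t : ℝ → ℝ → ℝ}

/-- An optimal mechanism loses no virtual surplus and leaves no excess rent, so that its quantities
and interim rents are those of `optimalQ` and `optimalRent`. -/
theorem IsOptimal.ae_eq (ho : E.IsOptimal p q t) (hE : E.MonotoneHazardRate) (hp : E.c < p)
    (h : E.IsCutoff p θs) :
    (∀ᵐ θ ∂E.signalLaw, ∀ᵐ z ∂E.shockLaw,
      q θ (θ * z) = E.alloc (E.cutoffFraction p θs θ) (θ * z)) ∧
    ∀ θ ∈ E.signals, E.rent q t θ = E.optimalRent p θs θ := by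
  have hf := ho.1
  have hf' := isFeasible_optimal hE hp h
  obtain ⟨hi, h1⟩ := hf.profit_sub_profit hE hp h
  have h2 := hf.integral_rentLoss_nonneg hE hp h
  have hnn : 0 ≤ᵐ[E.signalLaw] IsFeasible.surplusLoss E p θs q := by
    filter_upwards [E.ae_mem_signals] with θ hθ using hf.surplusLoss_nonneg hE hp h hθ
  have h3 := integral_nonneg_of_ae hnn
  have h4 := ho.2 _ _ hf'
  have h5 : ∫ θ, IsFeasible.surplusLoss E p θs q θ ∂E.signalLaw = 0 := by linarith
  have h6 : ∫ θ, IsFeasible.rentLoss E p θs q t θ ∂E.signalLaw = 0 := by linarith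
  have hq : ∀ᵐ θ ∂E.signalLaw, ∀ᵐ z ∂E.shockLaw,
      q θ (θ * z) = E.alloc (E.cutoffFraction p θs θ) (θ * z) := by
    filter_upwards [(integral_eq_zero_iff_of_nonneg_ae hnn hi).1 h5, E.ae_mem_signals]
      with θ h0 hθ
    exact hf.ae_eq_alloc hf' hθ (cutoffFraction_nonneg hE hp h θ hθ)
      (fun v _ => optimalQ_eq hθ v) (sub_eq_zero.1 h0).symm
  have hQ : ∀ᵐ θ ∂E.signalLaw, E.marginalRent q θ - E.marginalRent (E.optimalQ p θs) θ = 0 := by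
    filter_upwards [hq, E.ae_mem_signals] with θ hz hθ
    rw [sub_eq_zero]
    refine integral_congr_ae ?_
    filter_upwards [hz] with z hz
    rw [hz, optimalQ_eq hθ]
  -- equal marginal rents leave a constant excess rent, which is pure loss
  have hD : ∀ θ ∈ E.signals, E.rent q t θ - E.optimalRent p θs θ
      = E.rent q t E.θlo - E.spotUtility p E.θlo := by
    intro θ hθ
    rw [hf.rent_sub_optimalRent hE hp h hθ, add_eq_left]
    refine intervalIntegral.integral_zero_ae ?_
    filter_upwards [E.ae_volume_of_ae_signalLaw hQ] with x hx hxm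
    rw [uIoc_of_le hθ.1] at hxm
    exact hx ⟨hxm.1.le, hxm.2.trans hθ.2⟩
  have h7 : ∫ θ, IsFeasible.rentLoss E p θs q t θ ∂E.signalLaw
      = ∫ _, (E.rent q t E.θlo - E.spotUtility p E.θlo) ∂E.signalLaw := by
    refine integral_congr_ae ?_
    filter_upwards [hQ, E.ae_mem_signals] with θ h0 hθ
    rw [IsFeasible.rentLoss, h0, mul_zero, sub_zero, hD θ hθ]
  rw [h6, integral_const, probReal_univ, one_smul] at h7
  exact ⟨hq, fun θ hθ => sub_eq_zero.1 ((hD θ hθ).trans h7.symm)⟩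

/-- The quantities and the interim rent of a signal determine its transfers. -/
theorem IsFeasible.ae_transfer_eq (hf : E.IsFeasible p q t) {θ σ : ℝ} (hθ : θ ∈ E.signals)
    (hσ : 0 ≤ σ) (hq : ∀ᵐ z ∂E.shockLaw, q θ (θ * z) = E.alloc σ (θ * z)) :
    ∀ᵐ z ∂E.shockLaw, t θ (θ * z) = θ * z * E.alloc σ (θ * z) ^ E.α -
      (E.rent q t θ + E.slope σ * ((θ * z) ^ E.κ - θ ^ E.κ * E.shockMoment) / E.κ) := by
  have hθ0 := E.signals_nonneg hθ
  have hκ := E.κ_pos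
  set a := E.slope σ * θ ^ E.κ / E.κ with ha
  have hw : ∀ z ∈ Icc E.zlo E.zhi, E.expostPayoff q t θ (θ * z)
      = E.expostPayoff q t θ (θ * E.zlo) - a * E.zlo ^ E.κ + a * z ^ E.κ := by
    intro z hz
    have h1 := integral_subgradient (U := fun z => E.expostPayoff q t θ (θ * z))
      (Q := fun z => θ * q θ (θ * z) ^ E.α) E.zlo_lt.le (fun x hx y hy => by
        have := payoff_subgradient hf.ic1 hθ _ (E.mul_mem_values hθ hx) _ (E.mul_mem_values hθ hy)
        refine le_trans (le_of_eq ?_) this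
        ring) hz
    beta_reduce at h1
    have h2 : ∫ s in E.zlo..z, θ * q θ (θ * s) ^ E.α
        = ∫ s in E.zlo..z, (E.slope σ * θ ^ E.κ) * s ^ (E.κ - 1) := by
      refine intervalIntegral.integral_congr_ae ?_
      filter_upwards [E.ae_volume_of_ae_shockLaw hq] with s hs hsm
      rw [uIoc_of_le hz.1] at hsm
      have hs0 : 0 ≤ s := E.zlo_nonneg.trans hsm.1.le
      rw [hs ⟨hsm.1.le, hsm.2.trans hz.2⟩, E.alloc_rpow hσ (mul_nonneg hθ0 hs0),
        Real.mul_rpow hθ0 hs0, ← E.mul_rpow_κ_sub_one hθ0]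
      ring
    rw [h1, h2, intervalIntegral.integral_const_mul, integral_rpow_sub_one E.one_lt_κ, ha]
    ring
  have hmean : E.rent q t θ = E.expostPayoff q t θ (θ * E.zlo) - a * E.zlo ^ E.κ
      + a * E.shockMoment := by
    rw [rent, hf.interimUtility_eq]
    have h1 : ∫ z, E.expostPayoff q t θ (θ * z) ∂E.shockLaw
        = ∫ z, (E.expostPayoff q t θ (θ * E.zlo) - a * E.zlo ^ E.κ + a * z ^ E.κ)
          ∂E.shockLaw := by
      refine integral_congr_ae ?_
      filter_upwards [E.ae_mem_shocks] with z hz using hw z hz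
    rw [h1, integral_add (integrable_const _) ((E.integrable_rpow_shock hκ.le).const_mul _),
      integral_const_mul, ← shockMoment]
    simp
  filter_upwards [hq, E.ae_mem_shocks] with z hqz hz
  have h1 := hw z hz
  have hz0 := E.zlo_nonneg.trans hz.1
  rw [expostPayoff, payoff, hqz] at h1
  have h2 : E.slope σ * ((θ * z) ^ E.κ - θ ^ E.κ * E.shockMoment) / E.κ
      = a * z ^ E.κ - a * E.shockMoment := by
    rw [Real.mul_rpow hθ0 hz0, ha]; ring
  rw [h2, hmean]
  linarith

theorem IsOptimal.ae_quantity_iff (ho : E.IsOptimal p q t) (hE : E.MonotoneHazardRate)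
    (hp : E.c < p) (h : E.IsCutoff p θs) :
    ∀ᵐ θ ∂E.signalLaw, (∀ᵐ v ∂E.valueLaw θ, q θ v = E.qStar θ v) ↔ θs ≤ θ := by
  filter_upwards [(ho.ae_eq hE hp h).1, E.ae_mem_signals, E.ae_signalLaw_ne 0] with θ hq hθ hθ0
  have hpos : 0 < θ := lt_of_le_of_ne (E.signals_nonneg hθ) (Ne.symm hθ0)
  rw [E.ae_valueLaw_iff θ (measurableSet_eq_fun (ho.1.measurable_q θ) (E.measurable_qStar θ))]
  constructor
  · intro hq'
    obtain ⟨z, h1, h2, hz, hz0⟩ := (hq.and (hq'.and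
      (E.ae_mem_shocks.and (E.ae_shockLaw_ne 0)))).exists
    have hz' : 0 < z := lt_of_le_of_ne (E.zlo_nonneg.trans hz.1) (Ne.symm hz0)
    refine (optimalQ_eq_qStar_iff hE hp h hθ (mul_pos hpos hz')).1 ?_
    rw [optimalQ_eq hθ, ← h1, h2]
  · intro hle
    filter_upwards [hq, E.ae_mem_shocks] with z h1 hz
    rw [h1, ← optimalQ_eq hθ,
      optimalQ_eq_qStar hE hp h hθ (mul_nonneg hpos.le (E.zlo_nonneg.trans hz.1)) hle]

theorem IsOptimal.ae_transfer (ho : E.IsOptimal p q t) (hE : E.MonotoneHazardRate)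
    (hp : E.c < p) (h : E.IsCutoff p θs) :
    ∀ᵐ θ ∂E.signalLaw, θs ≤ θ →
      ∀ᵐ v ∂E.valueLaw θ, t θ v = E.tStar θ v - E.discount p θs := by
  filter_upwards [(ho.ae_eq hE hp h).1, E.ae_mem_signals] with θ hq hθ hle
  have h1 := ho.1.ae_transfer_eq hθ (cutoffFraction_nonneg hE hp h θ hθ) hq
  have h2 : ∀ᵐ v ∂E.valueLaw θ, t θ v = E.optimalT p θs θ v := by
    rw [E.ae_valueLaw_iff θ (measurableSet_eq_fun (ho.1.measurable_t θ)
      ((isFeasible_optimal hE hp h).measurable_t θ))]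
    filter_upwards [h1] with z hz
    rw [hz, optimalT, E.mechT_eq hθ, (ho.ae_eq hE hp h).2 θ hθ, optimalRent]
  filter_upwards [h2, E.ae_mem_values hθ] with v hv hvm
  rw [hv, optimalT_eq hE hp h hθ hvm hle]

end

end ServiceMarket

end

theorem mainTheorem4 (E : ServiceMarket) (hE : E.MonotoneHazardRate) (p : ℝ) (hp : E.c < p) :
    -- the cutoff is well defined
    (ContinuousOn E.f E.signals → ∃! θs, E.IsCutoff p θs) ∧
    ∀ θs, E.IsCutoff p θs →
      0 ≤ E.discount p θs ∧
      -- some optimal mechanism has the stated form at every signal and every value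
      (∃ qD tD : ℝ → ℝ → ℝ, E.IsOptimal p qD tD ∧
        (∀ θ ∈ E.signals, (∀ v ∈ E.values, qD θ v = E.qStar θ v) ↔ θs ≤ θ) ∧
        (∀ θ ∈ E.signals, θs ≤ θ → ∀ v ∈ E.values,
          tD θ v = E.tStar θ v - E.discount p θs)) ∧
      -- every optimal mechanism has the stated form up to null sets
      (∀ qD tD : ℝ → ℝ → ℝ, E.IsOptimal p qD tD →
        (∀ᵐ θ ∂E.signalLaw,
          (∀ᵐ v ∂(E.valueLaw θ), qD θ v = E.qStar θ v) ↔ θs ≤ θ) ∧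
        (∀ᵐ θ ∂E.signalLaw, θs ≤ θ →
          ∀ᵐ v ∂(E.valueLaw θ), tD θ v = E.tStar θ v - E.discount p θs)) := by
  refine ⟨fun hf => ?_, fun θs h => ⟨ServiceMarket.discount_nonneg hE hp h,
    ⟨E.optimalQ p θs, E.optimalT p θs, ServiceMarket.isOptimal_optimal hE hp h, fun θ hθ => ?_,
      fun θ hθ hle v hv => ServiceMarket.optimalT_eq hE hp h hθ hv hle⟩,
    fun qD tD ho => ⟨ho.ae_quantity_iff hE hp h, ho.ae_transfer hE hp h⟩⟩⟩
  · obtain ⟨θs, h⟩ := ServiceMarket.exists_isCutoff hE hp hf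
    exact ⟨θs, h, fun θ' h' => h'.unique hE hp h⟩
  · exact ⟨fun hq => (ServiceMarket.optimalQ_eq_qStar_iff hE hp h hθ E.vhi_pos).1 (hq _ E.vhi_mem),
      fun hle v hv => ServiceMarket.optimalQ_eq_qStar hE hp h hθ (E.values_nonneg hv) hle⟩
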